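/- Let $(\theta_p)_{p\in\mathcal P}$, indexed by the set $\mathcal P$ of prime numbers, be independent random variables on a probability space $(\Omega,\mathcal F,\mathbb P)$, each uniformly distributed on $[0,1]$, and put $U_p=e^{2\pi i\theta_p}$. For $s\in\mathbb C$ with $\operatorname{Re}s>1/2$ let $$\zeta_{\mathrm{rand}}(s)=\prod_{p\in\mathcal P}\frac{1}{1-p^{-s}U_p}=\lim_{N\to\infty}\prod_{p<N}\frac{1}{1-p^{-s}U_p},\qquad F(s)=\int_1^s\zeta_{\mathrm{rand}}(z)\,dz,$$ the integral being taken along the line segment from $1$ to $s$. Almost surely, the limit exists for all $s$ with $\operatorname{Re}s>1/2$ simultaneously, and $F$ is holomorphic there with $F'=\zeta_{\mathrm{rand}}$. Moreover: 1. For every $a>0$, almost surely $F$ is not injective on the open square $Q_a=\{\sigma+ih:\ 1/2<\sigma<1/2+2a,\ -a<h<a\}$, one side of which lies on the critical line $\operatorname{Re}s=1/2$. 2. Almost surely, for every neighbourhood $W\subset\mathbb C$ of the critical line $\{\operatorname{Re}s=1/2\}$, $F$ is not injective on $W\cap\{\operatorname{Re}s>1/2\}$. -/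

import Mathlib

noncomputable section

namespace RandomZeta

open Complex Filter

/-- The point `U = exp (2 π i θ)` of the unit circle with angle `θ`. -/
def unitPoint (θ : ℝ) : ℂ := Complex.exp (2 * Real.pi * Complex.I * θ)

/-- The partial Euler product `∏_{p < N} 1 / (1 - p^{-s} U_p)` attached to the angles `θ_p`. -/
def partialEuler (θ : Nat.Primes → ℝ) (N : ℕ) (s : ℂ) : ℂ :=
  ∏ p ∈ (Finset.range N).subtype Nat.Prime,
    1 / (1 - ((p : ℕ) : ℂ) ^ (-s) * unitPoint (θ p))

/-- The Euler product over all primes. For `1/2 < Re s ≤ 1` it is only conditionally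
convergent, so the primes are taken in increasing order. -/
def zetaRand (θ : Nat.Primes → ℝ) (s : ℂ) : ℂ :=
  limUnder atTop (fun N : ℕ => partialEuler θ N s)

/-- The primitive `F(s) = ∫_1^s ζ_rand(z) dz`, the integral being taken along the
segment from `1` to `s`. -/
def primitive (θ : Nat.Primes → ℝ) (s : ℂ) : ℂ :=
  ∫ t in (0 : ℝ)..1, zetaRand θ (1 + t * (s - 1)) * (s - 1)

/-- The open half-plane to the right of the critical line. -/
def rightHalfPlane : Set ℂ := {s | 1 / 2 < s.re}

/-- The critical line. -/
def criticalLine : Set ℂ := {s | s.re = 1 / 2}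

/-- The open square `(1/2, 1/2 + 2a) × (-a, a)`, one side of which lies on the critical line. -/
def square (a : ℝ) : Set ℂ := Set.Ioo (1 / 2) (1 / 2 + 2 * a) ×ℂ Set.Ioo (-a) a

end RandomZeta

end

/-! ### Univalent functions: a weak second-coefficient bound. -/

namespace RandomZeta

open Complex Filter Topology Metric Set

/-! Injectivity of `F` would bound its second derivative too tightly. The disc of radius `ε` about
`1/2 + ε` touches the critical line and lies in the square once `ε < a`. If `F` is injective there,
a Bieberbach-type bound (`norm_deriv_le_of_injOn_ball`) gives `|F''/F'| ≤ 320/ε` at the centre.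
Since `F' = ζ_rand = exp L`, this says `ε |L'(1/2 + ε)| ≤ 320`.

On the other hand, `-ε Re L'(1/2 + ε)` is, up to `O(1)`, the sum of the independent centred terms `ε
log p p^(-1/2-ε) cos(2πθ_p)`. Each term is at most `2ε`, while the variance stays between two
positive constants because `∑ log p p^(-x)` has a simple pole at `x = 1`
(`exists_tsum_coeff_sq_bounds`). Exponential moments and Paley–Zygmund then show that the sum
exceeds any fixed level with probability bounded below as `ε → 0`
(`exists_le_measureReal_lt_cosSum`). A finite set of primes has vanishing influence, so the zero-one
law upgrades this to probability one (`ae_frequently_lt_cosSum`), contradicting the bound.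

For `Re s ≤ 1` the product converges only conditionally. An L²-bounded martingale bounds the sums `∑
p^(-σ) U_p` almost surely, and Abel summation turns this into locally uniform convergence, hence
holomorphy (`ae_hasBoundedSums`, `exists_zetaRand_eq_exp`). -/

/-- The inverse of an injective holomorphic map with nonvanishing derivative is holomorphic. -/
lemma hasDerivAt_invFunOn {f f' : ℂ → ℂ} {U V : Set ℂ} (hU : IsOpen U)
    (hf : ∀ z ∈ U, HasDerivAt f (f' z) z) (hne : ∀ z ∈ U, f' z ≠ 0) (hinj : InjOn f U)
    (hV : V ⊆ f '' U) {y : ℂ} (hyV : y ∈ V) (hVo : IsOpen V) :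
    HasDerivAt (Function.invFunOn f U) (f' (Function.invFunOn f U y))⁻¹ y := by
  set g := Function.invFunOn f U
  have hgU : ∀ y ∈ V, g y ∈ U := fun y hy => Function.invFunOn_mem (hV hy)
  have hfg : ∀ y ∈ V, f (g y) = y := fun y hy => Function.invFunOn_eq (hV hy)
  have hdiff : DifferentiableOn ℂ f U := fun z hz => (hf z hz).differentiableAt.differentiableWithinAt
  have hstrict : HasStrictDerivAt f (f' (g y)) (g y) := by
    have := (hdiff.analyticAt (hU.mem_nhds (hgU y hyV))).hasStrictDerivAt
    rwa [(hf _ (hgU y hyV)).deriv] at this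
  have hmap := hstrict.map_nhds_eq (hne _ (hgU y hyV))
  rw [hfg y hyV] at hmap
  refine HasDerivAt.of_local_left_inverse ?_ (hf _ (hgU y hyV)) (hne _ (hgU y hyV))
    (by filter_upwards [hVo.mem_nhds hyV] with z hz using hfg z hz)
  -- Continuity of the inverse: `f` maps neighbourhoods of `g y` onto neighbourhoods of `y`.
  intro W hW
  have h1 : f '' (W ∩ U) ∈ 𝓝 y := by
    rw [← hmap]
    exact image_mem_map (inter_mem hW (hU.mem_nhds (hgU y hyV)))
  rw [mem_map]
  filter_upwards [h1, hVo.mem_nhds hyV] with z ⟨x, hx, hxz⟩ hz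
  change g z ∈ W
  have : g z = x := hinj (hgU z hz) hx.2 (by rw [hfg z hz, hxz])
  rw [this]; exact hx.1

/-- If the image of `ball c R` under an injective holomorphic map contains a ball of radius `d`
about the image of the centre, then `d` is at most `‖f' c‖ * R`. -/
lemma radius_le_of_ball_subset_image {f f' : ℂ → ℂ} {c : ℂ} {R d : ℝ} (hR : 0 < R) (hd : 0 < d)
    (hf : ∀ z ∈ ball c R, HasDerivAt f (f' z) z) (hne : ∀ z ∈ ball c R, f' z ≠ 0)
    (hinj : InjOn f (ball c R)) (hV : ball (f c) d ⊆ f '' ball c R) :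
    d ≤ ‖f' c‖ * R := by
  set g := Function.invFunOn f (ball c R)
  have hc : c ∈ ball c R := mem_ball_self hR
  have hgc : g (f c) = c := hinj.leftInvOn_invFunOn hc
  have hg : ∀ y ∈ ball (f c) d, HasDerivAt g (f' (g y))⁻¹ y := fun y hy =>
    hasDerivAt_invFunOn isOpen_ball hf hne hinj hV hy isOpen_ball
  have hmaps : MapsTo g (ball (f c) d) (ball (g (f c)) R) := by
    intro y hy
    rw [hgc]
    exact Function.invFunOn_mem (hV hy)
  -- Schwarz's lemma for the inverse, which maps a disc of radius `d` into one of radius `R`.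
  have h := Complex.norm_deriv_le_div_of_mapsTo_ball
    (fun y hy => (hg y hy).differentiableAt.differentiableWithinAt)
    (hmaps.mono_right ball_subset_closedBall) hd
  rw [(hg _ (mem_ball_self hd)).deriv, hgc, norm_inv] at h
  have h0 : 0 < ‖f' c‖ := norm_pos_iff.mpr (hne c hc)
  rw [inv_le_iff_one_le_mul₀ h0] at h
  have : d * 1 ≤ d * (R / d * ‖f' c‖) := mul_le_mul_of_nonneg_left h hd.le
  calc d = d * 1 := (mul_one d).symm
    _ ≤ _ := this
    _ = ‖f' c‖ * R := by field_simp

/-- A nonvanishing holomorphic function on a disc, equal to `1` at the centre, has a holomorphic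
square root equal to `1` at the centre. -/
lemma exists_sqrt_on_ball {k : ℂ → ℂ} {c : ℂ} {R : ℝ} (hR : 0 < R)
    (hk : DifferentiableOn ℂ k (ball c R)) (hk0 : ∀ z ∈ ball c R, k z ≠ 0) (hkc : k c = 1) :
    ∃ h : ℂ → ℂ, DifferentiableOn ℂ h (ball c R) ∧ h c = 1 ∧ ∀ z ∈ ball c R, h z ^ 2 = k z := by
  have hquot : DifferentiableOn ℂ (fun z => deriv k z / k z) (ball c R) :=
    (hk.deriv isOpen_ball).div hk hk0
  obtain ⟨l, hlc, hl⟩ := (hquot.isExactOn_ball).with_val_at c 0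
  have hc : c ∈ ball c R := mem_ball_self hR
  have hder : ∀ z ∈ ball c R, HasDerivAt (fun z => k z * exp (-l z)) 0 z := by
    intro z hz
    have h1 := (hk.differentiableAt (isOpen_ball.mem_nhds hz)).hasDerivAt
    have h2 := (hl z hz).neg.cexp
    convert! h1.mul h2 using 1
    have := hk0 z hz
    simp only [Pi.neg_apply]
    field_simp
    ring
  have hconst : ∀ z ∈ ball c R, k z * exp (-l z) = 1 := by
    intro z hz
    have := (convex_ball c R).is_const_of_fderivWithin_eq_zero (𝕜 := ℂ)
      (f := fun z => k z * exp (-l z))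
      (fun z hz => (hder z hz).differentiableAt.differentiableWithinAt)
      (fun z hz => by
        rw [fderivWithin_of_isOpen isOpen_ball hz]
        ext
        simp [(hder z hz).deriv]) hz hc
    simpa [hkc, hlc] using this
  refine ⟨fun z => exp (l z / 2), ?_, by simp [hlc], ?_⟩
  · intro z hz
    exact ((hl z hz).differentiableAt.div_const 2).cexp.differentiableWithinAt
  · intro z hz
    have h := hconst z hz
    rw [exp_neg] at h
    have : k z = exp (l z) := by
      have := exp_ne_zero (l z)
      field_simp at h
      exact h
    rw [this, ← exp_nat_mul]
    congr 1
    push_cast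
    ring

/-- A weak form of Bieberbach's bound for the second coefficient of a univalent function. -/
theorem norm_deriv_le_of_injOn_ball {f f' : ℂ → ℂ} {c : ℂ} {R : ℝ} (hR : 0 < R)
    (hf : ∀ z ∈ ball c R, HasDerivAt f (f' z) z) (hne : ∀ z ∈ ball c R, f' z ≠ 0)
    (hinj : InjOn f (ball c R)) :
    ‖deriv f' c‖ ≤ 320 * ‖f' c‖ / R := by
  have hc : c ∈ ball c R := mem_ball_self hR
  have hcompl : (f '' ball c R)ᶜ.Nonempty := by
    by_contra hempty
    rw [not_nonempty_iff_eq_empty, compl_empty_iff] at hempty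
    have h1 := radius_le_of_ball_subset_image hR (d := ‖f' c‖ * R + 1) (by positivity) hf hne hinj
      (by rw [hempty]; exact subset_univ _)
    linarith
  have hdiff : DifferentiableOn ℂ f (ball c R) :=
    fun z hz => (hf z hz).differentiableAt.differentiableWithinAt
  have hopen : IsOpen (f '' ball c R) := by
    rw [isOpen_iff_mem_nhds]
    rintro _ ⟨z, hz, rfl⟩
    have hs := (hdiff.analyticAt (isOpen_ball.mem_nhds hz)).hasStrictDerivAt
    rw [(hf z hz).deriv] at hs
    rw [← hs.map_nhds_eq (hne z hz)]
    exact image_mem_map (isOpen_ball.mem_nhds hz)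
  -- The nearest omitted value `w`: the disc about `f c` reaching out to `w` lies in the image, so
  -- its radius `d` is at most `‖f' c‖ * R`.
  obtain ⟨w, hw, hwd⟩ := hopen.isClosed_compl.exists_infDist_eq_dist hcompl (f c)
  set d := dist (f c) w with hd
  have hcw : f c ≠ w := by rintro h; exact hw ⟨c, hc, h⟩
  have hdpos : 0 < d := dist_pos.mpr hcw
  have hV : ball (f c) d ⊆ f '' ball c R := by
    rw [← hwd]; exact ball_infDist_compl_subset
  have hdle := radius_le_of_ball_subset_image hR hdpos hf hne hinj hV
  set A := f c - w with hA
  have hA0 : A ≠ 0 := sub_ne_zero.mpr hcw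
  have hAd : ‖A‖ = d := by rw [hd, dist_eq_norm]
  have hfw : ∀ z ∈ ball c R, f z - w ≠ 0 := by
    intro z hz h
    exact hw ⟨z, hz, sub_eq_zero.mp h⟩
  -- Koebe's square-root trick: since `f` is injective and omits `w`, the root of `(f - w)/A` cannot
  -- take both a value and its negative.
  obtain ⟨h, hhd, hhc, hh2⟩ := exists_sqrt_on_ball (k := fun z => (f z - w) / A) hR
    ((hdiff.sub_const w).div_const A) (fun z hz => div_ne_zero (hfw z hz) hA0)
    (by simp [hA, div_self (sub_ne_zero.mpr hcw)])
  have hfh : ∀ z ∈ ball c R, f z = w + A * h z ^ 2 := by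
    intro z hz
    rw [hh2 z hz]
    field_simp
    ring
  set g := Function.invFunOn f (ball c R)
  have hg : ∀ y ∈ ball (f c) d, HasDerivAt g (f' (g y))⁻¹ y := fun y hy =>
    hasDerivAt_invFunOn isOpen_ball hf hne hinj hV hy isOpen_ball
  have hgB : ∀ y ∈ ball (f c) d, g y ∈ ball c R := fun y hy => Function.invFunOn_mem (hV hy)
  have hfg : ∀ y ∈ ball (f c) d, f (g y) = y := fun y hy => Function.invFunOn_eq (hV hy)
  have hcontq : ContinuousOn (fun y => (h (g y)).re) (ball (f c) d) := by
    refine continuous_re.comp_continuousOn (hhd.continuousOn.comp ?_ hgB)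
    exact fun y hy => (hg y hy).continuousAt.continuousWithinAt
  -- On the disc of radius `d` the square of `h ∘ g` is within `1` of `1`, so `h ∘ g` never meets
  -- the imaginary axis; connectedness then keeps it in the right half-plane.
  have hreq : ∀ y ∈ ball (f c) d, (h (g y)).re ≠ 0 := by
    intro y hy h0
    have h1 := hh2 (g y) (hgB y hy)
    simp only [hfg y hy] at h1
    have h2 : ‖h (g y) ^ 2 - 1‖ < 1 := by
      rw [h1, show (y - w) / A - 1 = (y - f c) / A by field_simp; rw [hA]; ring, norm_div, hAd,
        div_lt_one hdpos, ← dist_eq_norm]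
      exact hy
    have h3 := (abs_re_le_norm _).trans_lt h2
    have h4 : (h (g y) ^ 2 - 1).re = -((h (g y)).im ^ 2) - 1 := by
      simp [pow_two, h0]
    rw [h4, abs_lt] at h3
    nlinarith [sq_nonneg (h (g y)).im]
  have hgfc : g (f c) = c := hinj.leftInvOn_invFunOn hc
  have hpos : ∀ y ∈ ball (f c) d, 0 < (h (g y)).re := by
    intro y hy
    by_contra hneg
    push Not at hneg
    obtain ⟨x, hx, hx0⟩ := (convex_ball (f c) d).isPreconnected.intermediate_value hy
      (mem_ball_self hdpos) hcontq (show (0 : ℝ) ∈ _ from ⟨hneg, by simp [hgfc, hhc]⟩)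
    exact hreq x hx hx0
  -- If `h z` were within `1/4` of `-1`, then `|h z ^ 2 - 1| < 9/16`, so `f z` would lie in that
  -- disc and force `Re (h z) > 0`.
  have homit : ∀ z ∈ ball c R, 1 / 4 ≤ ‖h z + 1‖ := by
    intro z hz
    by_contra hlt
    push Not at hlt
    have h1 : ‖h z - 1‖ ≤ 9 / 4 := by
      calc ‖h z - 1‖ = ‖(h z + 1) - 2‖ := by ring_nf
        _ ≤ ‖h z + 1‖ + ‖(2 : ℂ)‖ := norm_sub_le _ _
        _ ≤ 9 / 4 := by norm_num; linarith
    have h2 : ‖h z ^ 2 - 1‖ < 1 := by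
      rw [show h z ^ 2 - 1 = (h z + 1) * (h z - 1) by ring, norm_mul]
      nlinarith [norm_nonneg (h z + 1), norm_nonneg (h z - 1)]
    have h3 : f z ∈ ball (f c) d := by
      rw [mem_ball, dist_eq_norm, hfh z hz, show w + A * h z ^ 2 - f c = A * (h z ^ 2 - 1) by
        rw [hA]; ring, norm_mul, hAd]
      nlinarith
    have h4 := hpos _ h3
    rw [show g (f z) = z from hinj.leftInvOn_invFunOn hz] at h4
    have h5 := (abs_re_le_norm _).trans_lt hlt
    rw [abs_lt] at h5
    simp at h5
    linarith
  have hne1 : ∀ z ∈ ball c R, h z + 1 ≠ 0 := by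
    intro z hz h0
    have := homit z hz
    rw [h0, norm_zero] at this
    norm_num at this
  -- As `h` avoids a disc about `-1`, this inversion is bounded by `4`, and Cauchy's estimates on
  -- the disc of radius `R/2` control its first two derivatives.
  set G : ℂ → ℂ := fun z => (h z + 1)⁻¹ with hG
  have hGd : DifferentiableOn ℂ G (ball c R) := (hhd.add_const 1).inv hne1
  have hGb : ∀ z ∈ ball c R, ‖G z‖ ≤ 4 := by
    intro z hz
    rw [hG]
    simp only [norm_inv]
    rw [inv_le_comm₀ (norm_pos_iff.mpr (hne1 z hz)) (by norm_num)]
    linarith [homit z hz]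
  have hG0 : ∀ z ∈ ball c R, G z ≠ 0 := fun z hz => inv_ne_zero (hne1 z hz)
  have hsub : closedBall c (R / 2) ⊆ ball c R := closedBall_subset_ball (by linarith)
  have hcauchy : ∀ n : ℕ, ‖iteratedDeriv n G c‖ ≤ n.factorial * 4 / (R / 2) ^ n := by
    intro n
    refine norm_iteratedDeriv_le_of_forall_mem_sphere_norm_le n (by linarith) ?_
      fun z hz => hGb z (hsub (sphere_subset_closedBall hz))
    exact DifferentiableOn.diffContOnCl (hGd.mono (closure_ball_subset_closedBall.trans hsub))
  have hG1 := hcauchy 1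
  have hG2 := hcauchy 2
  rw [iteratedDeriv_one] at hG1
  rw [iteratedDeriv_succ, iteratedDeriv_one] at hG2
  have hGat : ∀ z ∈ ball c R, HasDerivAt G (deriv G z) z := fun z hz =>
    (hGd.differentiableAt (isOpen_ball.mem_nhds hz)).hasDerivAt
  have hG'at : HasDerivAt (deriv G) (deriv (deriv G) c) c :=
    ((hGd.deriv isOpen_ball).differentiableAt (isOpen_ball.mem_nhds hc)).hasDerivAt
  have hfG : ∀ z ∈ ball c R, f z = w + A * ((G z)⁻¹ - 1) ^ 2 := by
    intro z hz
    rw [hfh z hz, hG]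
    simp
  have hf'G : ∀ z ∈ ball c R, f' z = -2 * A * ((1 - G z) * deriv G z / G z ^ 3) := by
    intro z hz
    have h1 : HasDerivAt (fun z => w + A * ((G z)⁻¹ - 1) ^ 2) _ z :=
      (((((hGat z hz).inv (hG0 z hz)).sub_const 1).pow 2).const_mul A).const_add w
    have h2 : f =ᶠ[𝓝 z] fun z => w + A * ((G z)⁻¹ - 1) ^ 2 := by
      filter_upwards [isOpen_ball.mem_nhds hz] with x hx using hfG x hx
    rw [(hf z hz).unique (h1.congr_of_eventuallyEq h2)]
    have := hG0 z hz
    simp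
    field_simp
  have hGc : G c = 1 / 2 := by simp [hG, hhc]; norm_num
  have hf'c : f' c = -8 * A * deriv G c := by
    rw [hf'G c hc, hGc]; ring
  have hf''c : deriv f' c = -2 * A * (4 * deriv (deriv G) c - 32 * deriv G c ^ 2) := by
    have h1 : HasDerivAt (fun z => -2 * A * ((1 - G z) * deriv G z / G z ^ 3)) _ c :=
      (((((hGat c hc).const_sub 1).mul hG'at).div ((hGat c hc).pow 3)
        (pow_ne_zero 3 (hG0 c hc))).const_mul (-2 * A))
    have h2 : f' =ᶠ[𝓝 c] fun z => -2 * A * ((1 - G z) * deriv G z / G z ^ 3) := by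
      filter_upwards [isOpen_ball.mem_nhds hc] with x hx using hf'G x hx
    rw [(h1.congr_of_eventuallyEq h2).deriv]
    simp only [Pi.pow_apply, Pi.mul_apply, hGc]
    push_cast
    ring
  have e1 : ‖deriv G c‖ ≤ 8 / R := by
    refine hG1.trans (le_of_eq ?_)
    simp; field_simp; norm_num
  have e2 : ‖deriv (deriv G) c‖ ≤ 32 / R ^ 2 := by
    refine hG2.trans (le_of_eq ?_)
    simp; field_simp; norm_num
  have e3 : ‖f' c‖ = 8 * d * ‖deriv G c‖ := by
    rw [hf'c, norm_mul, norm_mul, hAd]; norm_num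
  calc ‖deriv f' c‖ = 2 * d * ‖4 * deriv (deriv G) c - 32 * deriv G c ^ 2‖ := by
        rw [hf''c, norm_mul, norm_mul, hAd]; norm_num
    _ ≤ 2 * d * (4 * ‖deriv (deriv G) c‖ + 32 * ‖deriv G c‖ ^ 2) := by
        gcongr
        refine (norm_sub_le _ _).trans (le_of_eq ?_)
        simp
    _ = 8 * d * ‖deriv (deriv G) c‖ + 8 * ‖f' c‖ * ‖deriv G c‖ := by rw [e3]; ring
    -- The two summands give `256` and `64`; the first uses `d ≤ ‖f' c‖ * R`.
    _ ≤ 8 * (‖f' c‖ * R) * (32 / R ^ 2) + 8 * ‖f' c‖ * (8 / R) := by gcongr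
    _ = 320 * ‖f' c‖ / R := by field_simp; ring

end RandomZeta

/-! ### Prime sums near the pole at `1`, and the size of the coefficients. -/

namespace RandomZeta

open Filter Topology Set

open ArithmeticFunction ArithmeticFunction.vonMangoldt in
/-- The Dirichlet series of the von Mangoldt function is `1 / (x - 1) + O(1)` as `x → 1⁺`. -/
lemma exists_abs_tsum_vonMangoldt_sub_le :
    ∃ C : ℝ, ∀ x ∈ Ioc (1 : ℝ) 2,
      |∑' n, residueClass (1 : ZMod 1) n / (n : ℝ) ^ x - 1 / (x - 1)| ≤ C := by
  have ha : IsUnit (1 : ZMod 1) := isUnit_one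
  have H {x : ℝ} (hx : 1 < x) :
      ∑' n, residueClass (1 : ZMod 1) n / (n : ℝ) ^ x =
        (LFunctionResidueClassAux (1 : ZMod 1) x).re + 1 / (x - 1) := by
    refine Complex.ofReal_injective ?_
    simp only [Complex.ofReal_tsum, Complex.ofReal_div, Complex.ofReal_cpow (Nat.cast_nonneg _),
      Complex.ofReal_natCast, Complex.ofReal_add, Complex.ofReal_sub, Complex.ofReal_one]
    simp_rw [← LFunctionResidueClassAux_real ha hx,
      eqOn_LFunctionResidueClassAux ha <| Set.mem_ofPred.mpr (Complex.ofReal_re x ▸ hx)]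
    simp only [Nat.totient_one, Nat.cast_one, inv_one, sub_add_cancel, LSeries, LSeries.term]
    refine tsum_congr fun n ↦ ?_
    split_ifs with hn
    · simp only [hn, residueClass_apply_zero, Complex.ofReal_zero, zero_div]
    · rfl
  -- With the pole removed, the function is continuous up to and including `x = 1`, hence bounded on
  -- the compact interval.
  have hcont : ContinuousOn (fun x : ℝ ↦ (LFunctionResidueClassAux (1 : ZMod 1) x).re)
      (Icc 1 2) :=
    Complex.continuous_re.continuousOn.comp (t := Set.univ)
      (continuousOn_LFunctionResidueClassAux (1 : ZMod 1)) (fun ⦃x⦄ a ↦ trivial) |>.comp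
      Complex.continuous_ofReal.continuousOn fun x hx ↦ by
        simpa only [Set.mem_ofPred_eq, Complex.ofReal_re] using hx.1
  obtain ⟨C, hC⟩ := isCompact_Icc.exists_bound_of_continuousOn hcont
  refine ⟨C, fun x hx => ?_⟩
  rw [H hx.1, add_sub_cancel_right]
  exact hC x (Ioc_subset_Icc_self hx)

/-- The Dirichlet series `∑ log p / p ^ x` over the primes. -/
noncomputable def primeLogSum (x : ℝ) : ℝ := ∑' p : Nat.Primes, Real.log p * (p : ℝ) ^ (-x)

open ArithmeticFunction ArithmeticFunction.vonMangoldt in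
lemma summable_vonMangoldt_div_rpow {x : ℝ} (hx : 1 < x) :
    Summable fun n : ℕ => residueClass (1 : ZMod 1) n / (n : ℝ) ^ x :=
  LSeries.summable_real_of_abscissaOfAbsConv_lt <|
    (abscissaOfAbsConv_residueClass_le_one _).trans_lt <| mod_cast hx

open ArithmeticFunction ArithmeticFunction.vonMangoldt in
lemma residueClass_one_prime (p : Nat.Primes) (x : ℝ) :
    residueClass (1 : ZMod 1) p / (p : ℝ) ^ x = Real.log p * (p : ℝ) ^ (-x) := by
  rw [Real.rpow_neg (Nat.cast_nonneg _), div_eq_mul_inv]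
  congr 1
  rw [residueClass, Set.indicator_of_mem (by simp; exact Subsingleton.elim _ _),
    vonMangoldt_apply_prime p.2]

lemma summable_primeLogSum {x : ℝ} (hx : 1 < x) :
    Summable fun p : Nat.Primes => Real.log p * (p : ℝ) ^ (-x) := by
  have := (summable_vonMangoldt_div_rpow hx).subtype {p : ℕ | p.Prime}
  refine this.congr fun p => ?_
  exact residueClass_one_prime p x

-- Higher prime powers contribute only `O(1)`: their part of the series still converges at `x = 1`
-- and dominates the parts for `x > 1`.
open ArithmeticFunction ArithmeticFunction.vonMangoldt in
lemma exists_abs_primeLogSum_sub_le :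
    ∃ C : ℝ, ∀ x ∈ Ioc (1 : ℝ) 2, |primeLogSum x - 1 / (x - 1)| ≤ C := by
  obtain ⟨C, hC⟩ := exists_abs_tsum_vonMangoldt_sub_le
  have hs := summable_residueClass_non_primes_div (1 : ZMod 1)
  refine ⟨C + ∑' n : ℕ, (if n.Prime then 0 else residueClass (1 : ZMod 1) n) / n, fun x hx => ?_⟩
  have hle : ∀ n : ℕ, (if n.Prime then 0 else residueClass (1 : ZMod 1) n) / (n : ℝ) ^ x ≤
      (if n.Prime then 0 else residueClass (1 : ZMod 1) n) / n := by
    intro n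
    rcases n.eq_zero_or_pos with rfl | hn
    · simp
    · refine div_le_div_of_nonneg_left ?_ (mod_cast hn) ?_
      · split_ifs
        exacts [le_rfl, residueClass_nonneg _ _]
      · conv_lhs => rw [← Real.rpow_one n]
        exact Real.rpow_le_rpow_of_exponent_le (by norm_cast) hx.1.le
  have h0 : ∀ n : ℕ, 0 ≤ (if n.Prime then 0 else residueClass (1 : ZMod 1) n) / (n : ℝ) ^ x := by
    intro n
    refine div_nonneg ?_ (by positivity)
    split_ifs
    exacts [le_rfl, residueClass_nonneg _ _]
  have hs' := Summable.of_nonneg_of_le h0 hle hs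
  have h1 := hs'.tsum_le_tsum hle hs
  have h2 : 0 ≤ ∑' n : ℕ, (if n.Prime then 0 else residueClass (1 : ZMod 1) n) / (n : ℝ) ^ x :=
    tsum_nonneg h0
  have hsplit : primeLogSum x = ∑' n, residueClass (1 : ZMod 1) n / (n : ℝ) ^ x -
      ∑' n : ℕ, (if n.Prime then 0 else residueClass (1 : ZMod 1) n) / (n : ℝ) ^ x := by
    rw [← (summable_vonMangoldt_div_rpow hx.1).tsum_sub hs', primeLogSum]
    have := tsum_subtype {p : ℕ | p.Prime} (fun n : ℕ => residueClass (1 : ZMod 1) n / (n : ℝ) ^ x)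
    calc _ = ∑' p : {p : ℕ | p.Prime}, residueClass (1 : ZMod 1) p / ((p : ℕ) : ℝ) ^ x :=
          tsum_congr fun p => (residueClass_one_prime p x).symm
      _ = _ := this
      _ = _ := by
          refine tsum_congr fun n => ?_
          by_cases hn : n.Prime <;> simp [hn]
  have h3 := hC x hx
  rw [abs_le] at h3 ⊢
  rw [hsplit]
  constructor <;> linarith [h3.1, h3.2]

lemma tendsto_subtype_range_atTop :
    Tendsto (fun N : ℕ => (Finset.range N).subtype Nat.Prime) atTop atTop := by
  refine tendsto_atTop_finset_of_monotone ?_ ?_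
  · intro a b hab p hp
    simp only [Finset.mem_subtype, Finset.mem_range] at hp ⊢
    omega
  · intro p
    exact ⟨p + 1, by simp⟩

/-- The coefficient `ε log p / p ^ (1/2 + ε)`. -/
noncomputable def coeff (ε : ℝ) (p : Nat.Primes) : ℝ := ε * (Real.log p * (p : ℝ) ^ (-(1 / 2 + ε)))

lemma coeff_nonneg {ε : ℝ} (hε : 0 ≤ ε) (p : Nat.Primes) : 0 ≤ coeff ε p :=
  mul_nonneg hε (mul_nonneg (Real.log_natCast_nonneg _) (by positivity))

lemma coeff_sq (ε : ℝ) (p : Nat.Primes) :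
    coeff ε p ^ 2 = ε ^ 2 * (Real.log p ^ 2 * (p : ℝ) ^ (-(1 + 2 * ε))) := by
  have h : ((p : ℝ) ^ (-(1 / 2 + ε))) ^ 2 = (p : ℝ) ^ (-(1 + 2 * ε)) := by
    rw [← Real.rpow_natCast, ← Real.rpow_mul (Nat.cast_nonneg _)]
    congr 1; push_cast; ring
  rw [coeff, mul_pow, mul_pow, h]

lemma log_le_rpow_div_prime (p : Nat.Primes) {ε : ℝ} (hε : 0 < ε) :
    Real.log p ≤ (p : ℝ) ^ ε / ε := Real.log_le_rpow_div (Nat.cast_nonneg _) hε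

/-- Follows from `log p ≤ 2 √p`. It makes every single prime negligible as `ε → 0`, which both the
exponential moments and the zero-one law need. -/
lemma coeff_le {ε : ℝ} (hε : 0 ≤ ε) (p : Nat.Primes) : coeff ε p ≤ 2 * ε := by
  have h1 := log_le_rpow_div_prime p (ε := 1 / 2) (by norm_num)
  have hp : (1 : ℝ) ≤ p := mod_cast p.2.one_lt.le
  have hp0 : (0 : ℝ) < p := by linarith
  have h2 : (p : ℝ) ^ (-(1 / 2 + ε)) ≤ (p : ℝ) ^ (-(1 / 2) : ℝ) :=
    Real.rpow_le_rpow_of_exponent_le hp (by linarith)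
  have h3 : (p : ℝ) ^ (1 / 2 : ℝ) * (p : ℝ) ^ (-(1 / 2) : ℝ) = 1 := by
    rw [← Real.rpow_add hp0]; simp
  have h4 : Real.log p * (p : ℝ) ^ (-(1 / 2 + ε)) ≤ 2 := by
    calc Real.log p * (p : ℝ) ^ (-(1 / 2 + ε))
        ≤ ((p : ℝ) ^ (1 / 2 : ℝ) / (1 / 2)) * (p : ℝ) ^ (-(1 / 2) : ℝ) := by gcongr
      _ = 2 * ((p : ℝ) ^ (1 / 2 : ℝ) * (p : ℝ) ^ (-(1 / 2) : ℝ)) := by ring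
      _ = 2 := by rw [h3, mul_one]
  rw [coeff]
  nlinarith

/-- Trading one logarithm for `p^ε / ε` leaves a series with a simple pole, which cancels the
remaining factor `ε`. -/
lemma coeff_sq_le {ε : ℝ} (hε : 0 < ε) (p : Nat.Primes) :
    coeff ε p ^ 2 ≤ ε * (Real.log p * (p : ℝ) ^ (-(1 + ε))) := by
  have hp0 : (0 : ℝ) < p := mod_cast p.2.pos
  have h1 := log_le_rpow_div_prime p hε
  have hlog : 0 ≤ Real.log p := Real.log_natCast_nonneg _
  have h2 : (p : ℝ) ^ (-(1 + ε)) = (p : ℝ) ^ ε * (p : ℝ) ^ (-(1 + 2 * ε)) := by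
    rw [← Real.rpow_add hp0]; congr 1; ring
  rw [coeff_sq, h2]
  calc ε ^ 2 * (Real.log p ^ 2 * (p : ℝ) ^ (-(1 + 2 * ε)))
      = ε ^ 2 * (Real.log p * Real.log p * (p : ℝ) ^ (-(1 + 2 * ε))) := by ring
    _ ≤ ε ^ 2 * (Real.log p * ((p : ℝ) ^ ε / ε) * (p : ℝ) ^ (-(1 + 2 * ε))) := by gcongr
    _ = _ := by field_simp

lemma summable_coeff_sq {ε : ℝ} (hε : 0 < ε) : Summable fun p => coeff ε p ^ 2 :=
  Summable.of_nonneg_of_le (fun _ => sq_nonneg _) (coeff_sq_le hε)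
    ((summable_primeLogSum (by linarith)).mul_left ε)

/-- The sums of squares of the coefficients stay between two positive constants. -/
lemma exists_tsum_coeff_sq_bounds :
    ∃ C : ℝ, 0 < C ∧ ∀ᶠ ε in 𝓝[>] (0 : ℝ),
      1 / 16 ≤ ∑' p, coeff ε p ^ 2 ∧ ∑' p, coeff ε p ^ 2 ≤ C := by
  obtain ⟨C, hC⟩ := exists_abs_primeLogSum_sub_le
  have hC0 : 0 ≤ C := (abs_nonneg _).trans (hC 2 (by norm_num))
  refine ⟨1 + C, by positivity, ?_⟩
  have hsmall : ∀ᶠ ε in 𝓝[>] (0 : ℝ), ε < min (1 / 4) (1 / (16 * (C + 1))) :=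
    nhdsWithin_le_nhds (eventually_lt_nhds (by positivity))
  filter_upwards [hsmall, self_mem_nhdsWithin] with ε hε1 (hε : 0 < ε)
  obtain ⟨hε2, hε3⟩ := lt_min_iff.mp hε1
  have hεC : ε * (C + 1) < 1 / 16 := by
    rw [lt_div_iff₀ (by positivity)] at hε3
    linarith
  constructor
  · have h1 := abs_le.mp (hC (1 + 2 * ε) ⟨by linarith, by linarith⟩)
    have h2 := abs_le.mp (hC (1 + 4 * ε) ⟨by linarith, by linarith⟩)
    -- The lower bound uses `1 - e^(-y) ≤ y` with `y = 2ε log p`. The difference of the two pole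
    -- terms is `1/(4ε)`, so the main term is `1/8`, of which the error consumes at most half.
    have hle : ∀ p : Nat.Primes, ε / 2 * (Real.log p * (p : ℝ) ^ (-(1 + 2 * ε)) -
        Real.log p * (p : ℝ) ^ (-(1 + 4 * ε))) ≤ coeff ε p ^ 2 := by
      intro p
      have hp0 : (0 : ℝ) < p := mod_cast p.2.pos
      have hlog : 0 ≤ Real.log p := Real.log_natCast_nonneg _
      have h3 : (p : ℝ) ^ (-(1 + 4 * ε)) =
          (p : ℝ) ^ (-(1 + 2 * ε)) * Real.exp (-(2 * ε * Real.log p)) := by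
        rw [show -(1 + 4 * ε) = -(1 + 2 * ε) + -(2 * ε) by ring, Real.rpow_add hp0,
          Real.rpow_def_of_pos hp0 (-(2 * ε))]
        congr 2; ring
      have h4 := Real.add_one_le_exp (-(2 * ε * Real.log p))
      rw [coeff_sq, h3]
      have h5 : 0 ≤ ε / 2 * (Real.log p * (p : ℝ) ^ (-(1 + 2 * ε))) := by positivity
      nlinarith [mul_le_mul_of_nonneg_left h4 h5]
    have h6 := Summable.tsum_le_tsum hle
      (((summable_primeLogSum (by linarith)).sub (summable_primeLogSum (by linarith))).mul_left _)
      (summable_coeff_sq hε)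
    rw [tsum_mul_left, (summable_primeLogSum (by linarith)).tsum_sub
      (summable_primeLogSum (by linarith))] at h6
    change ε / 2 * (primeLogSum _ - primeLogSum _) ≤ _ at h6
    refine le_trans ?_ h6
    have h7 : 1 / (1 + 2 * ε - 1) - 1 / (1 + 4 * ε - 1) = 1 / (4 * ε) := by
      rw [add_sub_cancel_left, add_sub_cancel_left]; field_simp; norm_num
    have h8 : 1 / (4 * ε) - 2 * C ≤ primeLogSum (1 + 2 * ε) - primeLogSum (1 + 4 * ε) := by
      linarith [h1.1, h2.2]
    calc (1 : ℝ) / 16 ≤ 1 / 8 - ε * C := by linarith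
      _ = ε / 2 * (1 / (4 * ε) - 2 * C) := by field_simp; ring
      _ ≤ _ := by gcongr
  · have h1 := abs_le.mp (hC (1 + ε) ⟨by linarith, by linarith⟩)
    have h2 := Summable.tsum_le_tsum (coeff_sq_le hε) (summable_coeff_sq hε)
      ((summable_primeLogSum (by linarith)).mul_left ε)
    rw [tsum_mul_left] at h2
    refine h2.trans ?_
    change ε * primeLogSum _ ≤ _
    have h3 : primeLogSum (1 + ε) ≤ 1 / ε + C := by
      have := h1.2
      rw [add_sub_cancel_left] at this
      linarith
    calc ε * primeLogSum (1 + ε) ≤ ε * (1 / ε + C) := by gcongr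
      _ = 1 + ε * C := by field_simp
      _ ≤ 1 + C := by nlinarith

/-- `ε ∑ log p / p ^ (1 + 2 ε)` stays bounded. -/
lemma exists_sum_log_bound :
    ∃ C : ℝ, ∀ ε ∈ Ioc (0 : ℝ) (1 / 2), ∀ s : Finset Nat.Primes,
      ε * ∑ p ∈ s, Real.log p * (p : ℝ) ^ (-(1 + 2 * ε)) ≤ C := by
  obtain ⟨C, hC⟩ := exists_abs_primeLogSum_sub_le
  have hC0 : 0 ≤ C := (abs_nonneg _).trans (hC 2 (by norm_num))
  refine ⟨1 + C, fun ε hε s => ?_⟩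
  have hε0 := hε.1
  have h1 := abs_le.mp (hC (1 + 2 * ε) ⟨by linarith [hε.1], by linarith [hε.2]⟩)
  have h2 : ∑ p ∈ s, Real.log p * (p : ℝ) ^ (-(1 + 2 * ε)) ≤ primeLogSum (1 + 2 * ε) :=
    (summable_primeLogSum (by linarith)).sum_le_tsum s
      fun p _ => mul_nonneg (Real.log_natCast_nonneg _) (by positivity)
  have h3 : primeLogSum (1 + 2 * ε) ≤ 1 / (2 * ε) + C := by
    have := h1.2
    rw [add_sub_cancel_left] at this
    linarith
  calc _ ≤ ε * (1 / (2 * ε) + C) := mul_le_mul_of_nonneg_left (h2.trans h3) hε0.le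
    _ = 1 / 2 + ε * C := by field_simp
    _ ≤ 1 + C := by nlinarith [hε.2]

end RandomZeta

/-! ### Conditional convergence of the random Euler product. -/

namespace RandomZeta

open Complex Filter Topology Set

/-- The set of primes below `N`. -/
abbrev primesBelow (N : ℕ) : Finset Nat.Primes := (Finset.range N).subtype Nat.Prime

lemma sum_primesBelow {M : Type*} [AddCommMonoid M] (f : ℕ → M) (N : ℕ) :
    ∑ p ∈ primesBelow N, f p = ∑ n ∈ Finset.range N, if n.Prime then f n else 0 := by
  rw [← Finset.sum_filter]
  exact Finset.sum_subtype_eq_sum_filter (s := Finset.range N) (p := Nat.Prime) f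

lemma sum_range_mul_eq_abel (a f : ℕ → ℂ) (N : ℕ) :
    ∑ n ∈ Finset.range N, a n * f n = (∑ n ∈ Finset.range N, a n) * f N +
      ∑ n ∈ Finset.range N, (∑ m ∈ Finset.range (n + 1), a m) * (f n - f (n + 1)) := by
  induction N with
  | zero => simp
  | succ N ih =>
    rw [Finset.sum_range_succ, ih, Finset.sum_range_succ (fun n => _ * (f n - f (n + 1))),
      Finset.sum_range_succ a N]
    ring

lemma norm_natCast_cpow_sub_succ_le {n : ℕ} (hn : 0 < n) {w : ℂ} (hw : 0 ≤ w.re) :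
    ‖(n : ℂ) ^ (-w) - ((n + 1 : ℕ) : ℂ) ^ (-w)‖ ≤ ‖w‖ * (n : ℝ) ^ (-w.re - 1) := by
  have hn0 : (0 : ℝ) < n := mod_cast hn
  have hderiv : ∀ x ∈ Icc (n : ℝ) (n + 1), HasDerivWithinAt (fun x : ℝ => (x : ℂ) ^ (-w))
      (-w * (x : ℂ) ^ (-w - 1)) (Icc (n : ℝ) (n + 1)) x := by
    intro x hx
    have hx0 : x ≠ 0 := (hn0.trans_le hx.1).ne'
    -- For exponent `0` the power rule used below does not apply, but the function is constant.
    by_cases hw0 : w = 0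
    · subst hw0
      simpa using (hasDerivAt_const x (1 : ℂ)).hasDerivWithinAt
    · exact (hasDerivAt_ofReal_cpow_const hx0 (neg_ne_zero.mpr hw0)).hasDerivWithinAt
  have hbound : ∀ x ∈ Icc (n : ℝ) (n + 1), ‖-w * (x : ℂ) ^ (-w - 1)‖ ≤
      ‖w‖ * (n : ℝ) ^ (-w.re - 1) := by
    intro x hx
    have hx0 : 0 < x := hn0.trans_le hx.1
    rw [norm_mul, norm_neg, norm_cpow_eq_rpow_re_of_pos hx0]
    simp only [sub_re, neg_re, one_re]
    exact mul_le_mul_of_nonneg_left (Real.rpow_le_rpow_of_nonpos hn0 hx.1 (by linarith))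
      (norm_nonneg _)
  have := (convex_Icc (n : ℝ) (n + 1)).norm_image_sub_le_of_norm_hasDerivWithin_le hderiv hbound
    (right_mem_Icc.mpr (by linarith)) (left_mem_Icc.mpr (by linarith))
  simpa using this

/-- A Dirichlet series with bounded partial sums at `0` converges uniformly on bounded
subsets of `{Re w ≥ δ}`, for every `δ > 0`. -/
lemma exists_tendstoUniformlyOn_dirichlet {a : ℕ → ℂ} (ha0 : a 0 = 0) {B : ℝ}
    (hB : ∀ N, ‖∑ n ∈ Finset.range N, a n‖ ≤ B) {δ M : ℝ} (hδ : 0 < δ) :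
    ∃ g : ℂ → ℂ, TendstoUniformlyOn
      (fun (N : ℕ) (w : ℂ) => ∑ n ∈ Finset.range N, a n * (n : ℂ) ^ (-w)) g atTop
      {w | δ ≤ w.re ∧ ‖w‖ ≤ M} := by
  have hB0 : 0 ≤ B := (norm_nonneg _).trans (hB 0)
  have hsum : Summable fun n : ℕ => B * M * (n : ℝ) ^ (-δ - 1) :=
    (Real.summable_nat_rpow.mpr (by linarith)).mul_left _
  -- After Abel summation the differences of `n^(-w)` gain a factor `1/n`, so the series is
  -- dominated by `B M n^(-δ-1)`; the boundary term is at most `B N^(-δ)`.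
  have h2 := tendstoUniformlyOn_tsum_nat (s := {w : ℂ | δ ≤ w.re ∧ ‖w‖ ≤ M})
    (f := fun (n : ℕ) (w : ℂ) => (∑ m ∈ Finset.range (n + 1), a m) *
      ((n : ℂ) ^ (-w) - ((n + 1 : ℕ) : ℂ) ^ (-w))) hsum (by
    intro n w hw
    have hM : 0 ≤ M := (norm_nonneg _).trans hw.2
    rcases Nat.eq_zero_or_pos n with rfl | hn
    · simp [ha0]
      positivity
    · rw [norm_mul, mul_assoc]
      refine mul_le_mul (hB _) ?_ (norm_nonneg _) hB0
      refine (norm_natCast_cpow_sub_succ_le hn (hδ.le.trans hw.1)).trans ?_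
      refine mul_le_mul hw.2 ?_ (by positivity) hM
      exact Real.rpow_le_rpow_of_exponent_le (mod_cast hn) (by linarith [hw.1]))
  have h1 : TendstoUniformlyOn
      (fun (N : ℕ) (w : ℂ) => (∑ n ∈ Finset.range N, a n) * (N : ℂ) ^ (-w)) 0 atTop
      {w | δ ≤ w.re ∧ ‖w‖ ≤ M} := by
    rw [Metric.tendstoUniformlyOn_iff]
    intro ε hε
    have hlim : Tendsto (fun N : ℕ => B * (N : ℝ) ^ (-δ)) atTop (𝓝 0) := by
      simpa using ((tendsto_rpow_neg_atTop hδ).comp tendsto_natCast_atTop_atTop).const_mul B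
    filter_upwards [hlim.eventually_lt_const hε, eventually_gt_atTop 0] with N hN hN0 w hw
    rw [Pi.zero_apply, dist_zero_left, norm_mul,
      norm_natCast_cpow_of_pos hN0]
    refine lt_of_le_of_lt ?_ hN
    refine mul_le_mul (hB N) ?_ (by positivity) hB0
    exact Real.rpow_le_rpow_of_exponent_le (mod_cast hN0) (by simpa using hw.1)
  refine ⟨_, (h1.add h2).congr (Eventually.of_forall fun N w _ => ?_)⟩
  exact (sum_range_mul_eq_abel a (fun n => (n : ℂ) ^ (-w)) N).symm

lemma norm_unitPoint (t : ℝ) : ‖unitPoint t‖ = 1 := by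
  rw [unitPoint, show 2 * (Real.pi : ℂ) * I * t = ((2 * Real.pi * t : ℝ) : ℂ) * I by
    push_cast; ring]
  exact norm_exp_ofReal_mul_I _

lemma unitPoint_re (t : ℝ) : (unitPoint t).re = Real.cos (2 * Real.pi * t) := by
  rw [unitPoint, show 2 * (Real.pi : ℂ) * I * t = ((2 * Real.pi * t : ℝ) : ℂ) * I by
    push_cast; ring]
  exact exp_ofReal_mul_I_re _

lemma unitPoint_im (t : ℝ) : (unitPoint t).im = Real.sin (2 * Real.pi * t) := by
  rw [unitPoint, show 2 * (Real.pi : ℂ) * I * t = ((2 * Real.pi * t : ℝ) : ℂ) * I by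
    push_cast; ring]
  exact exp_ofReal_mul_I_im _

/-- The term `p^{-s} U_p`. -/
noncomputable def eulerTerm (θ : Nat.Primes → ℝ) (p : Nat.Primes) (s : ℂ) : ℂ :=
  ((p : ℕ) : ℂ) ^ (-s) * unitPoint (θ p)

lemma norm_eulerTerm (θ : Nat.Primes → ℝ) (p : Nat.Primes) (s : ℂ) :
    ‖eulerTerm θ p s‖ = (p : ℝ) ^ (-s.re) := by
  rw [eulerTerm, norm_mul, norm_unitPoint, mul_one, norm_natCast_cpow_of_pos p.2.pos, neg_re]

/-- The worst case is `2^(-1/2)`. A bound below `1`, uniform in `p` and `s`, keeps `1 - p^(-s) U_p`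
in the domain of the principal logarithm and away from `0`. -/
lemma norm_eulerTerm_le (θ : Nat.Primes → ℝ) (p : Nat.Primes) {s : ℂ} (hs : s ∈ rightHalfPlane) :
    ‖eulerTerm θ p s‖ ≤ 3 / 4 := by
  have hs' : 1 / 2 < s.re := hs
  have hp : (2 : ℝ) ≤ p := mod_cast p.2.two_le
  rw [norm_eulerTerm]
  calc (p : ℝ) ^ (-s.re) ≤ (2 : ℝ) ^ (-s.re) :=
        Real.rpow_le_rpow_of_nonpos (by norm_num) hp (by linarith)
    _ ≤ (2 : ℝ) ^ (-(1 / 2) : ℝ) := Real.rpow_le_rpow_of_exponent_le (by norm_num) (by linarith)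
    _ ≤ 3 / 4 := by
        rw [Real.rpow_neg (by norm_num), ← Real.sqrt_eq_rpow]
        rw [inv_le_comm₀ (by positivity) (by norm_num)]
        exact Real.le_sqrt_of_sq_le (by norm_num)

lemma one_sub_eulerTerm_mem_slitPlane (θ : Nat.Primes → ℝ) (p : Nat.Primes) {s : ℂ}
    (hs : s ∈ rightHalfPlane) : 1 - eulerTerm θ p s ∈ slitPlane := by
  refine Or.inl ?_
  have h1 := (re_le_norm _).trans (norm_eulerTerm_le θ p hs)
  simp only [sub_re, one_re]
  linarith

lemma norm_one_sub_eulerTerm_ge (θ : Nat.Primes → ℝ) (p : Nat.Primes) {s : ℂ}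
    (hs : s ∈ rightHalfPlane) : 1 / 4 ≤ ‖1 - eulerTerm θ p s‖ := by
  have h1 := norm_eulerTerm_le θ p hs
  have h2 := norm_sub_norm_le (1 : ℂ) (eulerTerm θ p s)
  rw [norm_one] at h2
  linarith

lemma hasDerivAt_eulerTerm (θ : Nat.Primes → ℝ) (p : Nat.Primes) (s : ℂ) :
    HasDerivAt (eulerTerm θ p) (-(Real.log p * eulerTerm θ p s)) s := by
  have hp : ((p : ℕ) : ℂ) ≠ 0 := mod_cast p.2.ne_zero
  have := ((hasDerivAt_neg s).const_cpow (c := ((p : ℕ) : ℂ)) (Or.inl hp)).mul_const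
    (unitPoint (θ p))
  convert! this using 1
  rw [eulerTerm, natCast_log]
  ring

/-- The partial sums of `log ζ_rand`. -/
noncomputable def partialLog (θ : Nat.Primes → ℝ) (N : ℕ) (s : ℂ) : ℂ :=
  ∑ p ∈ primesBelow N, -log (1 - eulerTerm θ p s)

/-- The partial sums of `(log ζ_rand)'`. -/
noncomputable def partialLogDeriv (θ : Nat.Primes → ℝ) (N : ℕ) (s : ℂ) : ℂ :=
  ∑ p ∈ primesBelow N, -(Real.log p * eulerTerm θ p s / (1 - eulerTerm θ p s))

lemma exp_partialLog (θ : Nat.Primes → ℝ) (N : ℕ) {s : ℂ} (hs : s ∈ rightHalfPlane) :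
    exp (partialLog θ N s) = partialEuler θ N s := by
  rw [partialLog, exp_sum, partialEuler]
  refine Finset.prod_congr rfl fun p _ => ?_
  rw [exp_neg, exp_log (slitPlane_ne_zero (one_sub_eulerTerm_mem_slitPlane θ p hs)), one_div,
    eulerTerm]

lemma hasDerivAt_partialLog (θ : Nat.Primes → ℝ) (N : ℕ) {s : ℂ} (hs : s ∈ rightHalfPlane) :
    HasDerivAt (partialLog θ N) (partialLogDeriv θ N s) s := by
  have : HasDerivAt (fun s => ∑ p ∈ primesBelow N, -log (1 - eulerTerm θ p s))
      (partialLogDeriv θ N s) s := by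
    refine HasDerivAt.fun_sum fun p _ => ?_
    have := (((hasDerivAt_eulerTerm θ p s).const_sub 1).clog
      (one_sub_eulerTerm_mem_slitPlane θ p hs)).neg
    convert! this using 1
    simp only [neg_neg]
  exact this

lemma isOpen_rightHalfPlane : IsOpen rightHalfPlane :=
  isOpen_lt continuous_const continuous_re

lemma tendstoUniformlyOn_of_finset {f : Nat.Primes → ℂ → ℂ} {g : ℂ → ℂ} {t : Set ℂ}
    (h : TendstoUniformlyOn (fun (s : Finset Nat.Primes) z => ∑ p ∈ s, f p z) g atTop t) :
    TendstoUniformlyOn (fun (N : ℕ) z => ∑ p ∈ primesBelow N, f p z) g atTop t :=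
  fun u hu => tendsto_subtype_range_atTop.eventually (h u hu)

/-- The sums `∑_{p < N} p^{-σ} U_p` stay bounded for `σ = 1/2 + 1/(j+1)`, `j : ℕ`. -/
def HasBoundedSums (θ : Nat.Primes → ℝ) : Prop :=
  ∀ j : ℕ, ∃ B : ℝ, ∀ N : ℕ,
    ‖∑ p ∈ primesBelow N, eulerTerm θ p ((1 / 2 + 1 / (j + 1) : ℝ) : ℂ)‖ ≤ B

/-- Factor `p^(-s) = p^(-σ) p^(-(s-σ))` with `σ` one of the abscissae where the sums are bounded and
`σ < Re s₀`; what remains is a Dirichlet series in `s - σ`. -/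
lemma exists_tendstoUniformlyOn_sum_eulerTerm {θ : Nat.Primes → ℝ} (hθ : HasBoundedSums θ)
    {s₀ : ℂ} (hs₀ : s₀ ∈ rightHalfPlane) :
    ∃ t ∈ 𝓝 s₀, ∃ g : ℂ → ℂ, TendstoUniformlyOn
      (fun (N : ℕ) s => ∑ p ∈ primesBelow N, eulerTerm θ p s) g atTop t := by
  have hs : 1 / 2 < s₀.re := hs₀
  -- A third of the distance to the critical line: with `1/(j+1) < δ` this leaves `Re (s₀ - σ) >
  -- 2δ`.
  set δ := (s₀.re - 1 / 2) / 3 with hδ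
  have hδ0 : 0 < δ := by rw [hδ]; linarith
  obtain ⟨j, hj⟩ := exists_nat_one_div_lt hδ0
  obtain ⟨B, hB⟩ := hθ j
  set σ : ℝ := 1 / 2 + 1 / (j + 1) with hσ
  set a : ℕ → ℂ := fun n => if hn : n.Prime then eulerTerm θ ⟨n, hn⟩ σ else 0 with ha
  have hsum : ∀ (N : ℕ) (f : ℕ → ℂ), ∑ n ∈ Finset.range N, a n * f n =
      ∑ p ∈ primesBelow N, eulerTerm θ p σ * f p := by
    intro N f
    have h1 := sum_primesBelow (fun n => a n * f n) N
    have h2 : ∀ n, (if n.Prime then a n * f n else 0) = a n * f n := by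
      intro n
      by_cases hn : n.Prime <;> simp [ha, hn]
    simp only [h2] at h1
    rw [← h1]
    refine Finset.sum_congr rfl fun p _ => ?_
    have : a p = eulerTerm θ p σ := by
      simp only [ha]
      exact dif_pos p.2
    rw [this]
  obtain ⟨g, hg⟩ := exists_tendstoUniformlyOn_dirichlet (a := a) (B := B) (δ := δ)
    (M := ‖s₀ - σ‖ + 1) (by simp [ha, Nat.not_prime_zero]) (fun N => by
      have := hsum N (fun _ => 1)
      simp only [mul_one] at this
      rw [this]
      exact hB N) hδ0
  refine ⟨{s : ℂ | δ ≤ (s - σ).re ∧ ‖s - σ‖ ≤ ‖s₀ - σ‖ + 1}, ?_, fun s => g (s - σ), ?_⟩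
  · have h1 : ∀ᶠ s : ℂ in 𝓝 s₀, δ < (s - σ).re := by
      refine ContinuousAt.eventually_lt continuousAt_const (by fun_prop) ?_
      simp only [sub_re, ofReal_re]
      rw [hσ]; linarith
    have h2 : ∀ᶠ s : ℂ in 𝓝 s₀, ‖s - σ‖ < ‖s₀ - σ‖ + 1 :=
      ContinuousAt.eventually_lt (by fun_prop) continuousAt_const (by linarith)
    filter_upwards [h1, h2] with s h1 h2 using ⟨h1.le, h2.le⟩
  · refine (hg.comp (fun s => s - (σ : ℂ))).congr (Eventually.of_forall fun N s _ => ?_)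
    change ∑ n ∈ Finset.range N, a n * (n : ℂ) ^ (-(s - σ)) = _
    rw [hsum N (fun n => (n : ℂ) ^ (-(s - σ)))]
    refine Finset.sum_congr rfl fun p _ => ?_
    have hp : ((p : ℕ) : ℂ) ≠ 0 := mod_cast p.2.ne_zero
    rw [eulerTerm, eulerTerm, show -s = -(σ : ℂ) + -(s - σ) by ring, cpow_add _ _ hp]
    ring

/-- Only the linear part of the logarithm converges conditionally: the remainder is at most `2
p^(-2σ)`, absolutely summable since `2σ > 1`. -/
lemma exists_tendstoUniformlyOn_partialLog {θ : Nat.Primes → ℝ} (hθ : HasBoundedSums θ)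
    {s₀ : ℂ} (hs₀ : s₀ ∈ rightHalfPlane) :
    ∃ t ∈ 𝓝 s₀, ∃ g : ℂ → ℂ, TendstoUniformlyOn (partialLog θ) g atTop t := by
  obtain ⟨t, ht, g, hg⟩ := exists_tendstoUniformlyOn_sum_eulerTerm hθ hs₀
  have hs : 1 / 2 < s₀.re := hs₀
  set σ := (s₀.re + 1 / 2) / 2 with hσ
  have hσ1 : 1 / 2 < σ := by rw [hσ]; linarith
  have hu : Summable fun p : Nat.Primes => 2 * (p : ℝ) ^ (-(2 * σ)) :=
    (Nat.Primes.summable_rpow.mpr (by linarith)).mul_left 2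
  have h2 := tendstoUniformlyOn_of_finset (tendstoUniformlyOn_tsum
    (f := fun p s => -log (1 - eulerTerm θ p s) - eulerTerm θ p s) hu
    (s := {s : ℂ | σ < s.re}) (by
      intro p s (hs : σ < s.re)
      have hmem : s ∈ rightHalfPlane := hσ1.trans hs
      have hx := norm_eulerTerm_le θ p hmem
      have h3 := norm_log_one_add_sub_self_le (z := -eulerTerm θ p s)
        (by rw [norm_neg]; linarith)
      rw [norm_neg] at h3
      rw [← norm_neg, show -(-log (1 - eulerTerm θ p s) - eulerTerm θ p s) =
        log (1 + -eulerTerm θ p s) - -eulerTerm θ p s by ring_nf]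
      refine h3.trans ?_
      have h4 : (1 - ‖eulerTerm θ p s‖)⁻¹ ≤ 4 := by
        rw [inv_le_comm₀ (by linarith) (by norm_num)]
        linarith
      have hp : (1 : ℝ) ≤ p := mod_cast p.2.one_lt.le
      have h5 : ‖eulerTerm θ p s‖ ^ 2 ≤ (p : ℝ) ^ (-(2 * σ)) := by
        rw [norm_eulerTerm, ← Real.rpow_natCast, ← Real.rpow_mul (by linarith)]
        exact Real.rpow_le_rpow_of_exponent_le hp (by push_cast; linarith)
      have h6 : 0 ≤ (1 - ‖eulerTerm θ p s‖)⁻¹ := inv_nonneg.mpr (by linarith)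
      calc _ ≤ (p : ℝ) ^ (-(2 * σ)) * 4 / 2 := by gcongr
        _ = _ := by ring))
  refine ⟨t ∩ {s : ℂ | σ < s.re}, inter_mem ht ((isOpen_lt continuous_const continuous_re).mem_nhds
    (show σ < s₀.re by rw [hσ]; linarith)), _,
    ((hg.mono inter_subset_left).add (h2.mono inter_subset_right)).congr
      (Eventually.of_forall fun N s _ => ?_)⟩
  simp [partialLog, Finset.sum_sub_distrib]

/-- Under bounded sums, `log ζ_rand` is a holomorphic function on the half-plane, the limit of its
partial sums together with its derivative. -/
theorem exists_log_zetaRand {θ : Nat.Primes → ℝ} (hθ : HasBoundedSums θ) :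
    ∃ L : ℂ → ℂ, DifferentiableOn ℂ L rightHalfPlane ∧ ∀ s ∈ rightHalfPlane,
      Tendsto (fun N => partialLog θ N s) atTop (𝓝 (L s)) ∧
      Tendsto (fun N => partialLogDeriv θ N s) atTop (𝓝 (deriv L s)) := by
  set L : ℂ → ℂ := fun s => limUnder atTop fun N => partialLog θ N s
  have hloc : TendstoLocallyUniformlyOn (partialLog θ) L atTop rightHalfPlane := by
    refine tendstoLocallyUniformlyOn_of_forall_exists_nhds fun s hs => ?_
    obtain ⟨t, ht, g, hg⟩ := exists_tendstoUniformlyOn_partialLog hθ hs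
    exact ⟨t, mem_nhdsWithin_of_mem_nhds ht,
      hg.congr_right fun z hz => (hg.tendsto_at hz).limUnder_eq.symm⟩
  have hd : ∀ᶠ N in atTop, DifferentiableOn ℂ (partialLog θ N) rightHalfPlane :=
    Eventually.of_forall fun N s hs =>
      (hasDerivAt_partialLog θ N hs).differentiableAt.differentiableWithinAt
  refine ⟨L, hloc.differentiableOn hd isOpen_rightHalfPlane, fun s hs => ⟨hloc.tendsto_at hs, ?_⟩⟩
  refine ((hloc.deriv hd isOpen_rightHalfPlane).tendsto_at hs).congr fun N => ?_
  exact (hasDerivAt_partialLog θ N hs).deriv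

end RandomZeta

/-! ### The primitive `F`, and what its injectivity would imply. -/

namespace RandomZeta

open Complex Filter Topology Set

/-- Large discs tangent to the critical line at `1/2` exhaust the half-plane. One disc holding both
endpoints lets the segment integral be computed from a primitive on that disc. -/
lemma exists_ball_subset_rightHalfPlane {s : ℂ} (hs : s ∈ rightHalfPlane) :
    ∃ (c : ℂ) (R : ℝ), Metric.ball c R ⊆ rightHalfPlane ∧ 1 ∈ Metric.ball c R ∧
      s ∈ Metric.ball c R := by
  have hs' : 0 < s.re - 1 / 2 := by
    have : 1 / 2 < s.re := hs
    linarith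
  set x := s.re - 1 / 2 with hx
  set R : ℝ := 1 + (x ^ 2 + s.im ^ 2) / x with hR
  have hR1 : 1 ≤ R := by
    have : 0 ≤ (x ^ 2 + s.im ^ 2) / x := by positivity
    linarith
  have hRx : x ^ 2 + s.im ^ 2 < 2 * R * x := by
    have : R * x = x + (x ^ 2 + s.im ^ 2) := by rw [hR]; field_simp
    nlinarith [sq_nonneg s.im, sq_nonneg x]
  have hmem : ∀ z : ℂ, z ∈ Metric.ball (((1 / 2 + R : ℝ)) : ℂ) R ↔
      (z.re - (1 / 2 + R)) ^ 2 + z.im ^ 2 < R ^ 2 := by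
    intro z
    rw [Metric.mem_ball, dist_eq_norm, ← sq_lt_sq₀ (norm_nonneg _) (by linarith), ← normSq_eq_norm_sq,
      normSq_apply]
    simp [pow_two]
  refine ⟨((1 / 2 + R : ℝ) : ℂ), R, ?_, ?_, ?_⟩
  · intro z hz
    rw [hmem] at hz
    change 1 / 2 < z.re
    nlinarith [sq_nonneg z.im, sq_nonneg (z.re - 1 / 2)]
  · rw [hmem]
    simp only [one_re, one_im]
    nlinarith
  · rw [hmem]
    have : s.re = x + 1 / 2 := by rw [hx]; ring
    rw [this]
    nlinarith

/-- If `ζ_rand` is holomorphic on the half-plane, then `F` is a primitive of it. -/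
lemma hasDerivAt_primitive {θ : Nat.Primes → ℝ}
    (hd : DifferentiableOn ℂ (zetaRand θ) rightHalfPlane) {s : ℂ} (hs : s ∈ rightHalfPlane) :
    HasDerivAt (primitive θ) (zetaRand θ s) s := by
  obtain ⟨c, R, hsub, h1, hsR⟩ := exists_ball_subset_rightHalfPlane hs
  obtain ⟨G, hG⟩ := (hd.mono hsub).isExactOn_ball
  have hprim : ∀ z ∈ Metric.ball c R, primitive θ z = G z - G 1 := by
    intro z hz
    have hseg : ∀ t ∈ Icc (0 : ℝ) 1, (1 : ℂ) + t * (z - 1) ∈ Metric.ball c R := by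
      intro t ht
      have := (convex_ball c R).add_smul_sub_mem h1 hz ht
      simpa using this
    have hder : ∀ t ∈ Icc (0 : ℝ) 1, HasDerivAt (fun t : ℝ => G (1 + t * (z - 1)))
        (zetaRand θ (1 + t * (z - 1)) * (z - 1)) t := by
      intro t ht
      have h2 : HasDerivAt (fun t : ℝ => (1 : ℂ) + t * (z - 1)) (z - 1) t := by
        simpa using ((hasDerivAt_id t).ofReal_comp.mul_const (z - 1)).const_add 1
      exact (hG _ (hseg t ht)).comp t h2
    have hcont : ContinuousOn (fun t : ℝ => zetaRand θ (1 + t * (z - 1)) * (z - 1)) (Icc 0 1) := by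
      refine ContinuousOn.mul ?_ continuousOn_const
      refine (hd.continuousOn.mono hsub).comp ?_ hseg
      fun_prop
    have := intervalIntegral.integral_eq_sub_of_hasDerivAt (a := 0) (b := 1)
      (f := fun t : ℝ => G (1 + t * (z - 1)))
      (f' := fun t : ℝ => zetaRand θ (1 + t * (z - 1)) * (z - 1))
      (by rw [uIcc_of_le zero_le_one]; exact hder)
      (by
        apply ContinuousOn.intervalIntegrable
        rw [uIcc_of_le zero_le_one]; exact hcont)
    rw [primitive, this]
    simp
  have h3 : primitive θ =ᶠ[𝓝 s] fun z => G z - G 1 := by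
    filter_upwards [Metric.isOpen_ball.mem_nhds hsR] with z hz using hprim z hz
  exact ((hG s hsR).sub_const _).congr_of_eventuallyEq h3

/-- Under bounded sums the Euler product converges on the half-plane to the exponential of a
holomorphic function, and `F` is a primitive of it. -/
theorem exists_zetaRand_eq_exp {θ : Nat.Primes → ℝ} (hθ : HasBoundedSums θ) :
    ∃ L : ℂ → ℂ, DifferentiableOn ℂ L rightHalfPlane ∧ ∀ s ∈ rightHalfPlane,
      Tendsto (fun N => partialEuler θ N s) atTop (𝓝 (zetaRand θ s)) ∧
      zetaRand θ s = exp (L s) ∧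
      HasDerivAt (primitive θ) (zetaRand θ s) s ∧
      Tendsto (fun N => partialLogDeriv θ N s) atTop (𝓝 (deriv L s)) := by
  obtain ⟨L, hL, hlim⟩ := exists_log_zetaRand hθ
  have hE : ∀ s ∈ rightHalfPlane, Tendsto (fun N => partialEuler θ N s) atTop (𝓝 (exp (L s))) :=
    fun s hs => ((continuous_exp.tendsto _).comp (hlim s hs).1).congr
      fun N => exp_partialLog θ N hs
  have hz : ∀ s ∈ rightHalfPlane, zetaRand θ s = exp (L s) := fun s hs => (hE s hs).limUnder_eq
  have hd : DifferentiableOn ℂ (zetaRand θ) rightHalfPlane := hL.cexp.congr hz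
  exact ⟨L, hL, fun s hs => ⟨by rw [hz s hs]; exact hE s hs, hz s hs,
    hasDerivAt_primitive hd hs, (hlim s hs).2⟩⟩

/-- The normalized random sum `ε ∑_{p < N} log p p^{-1/2-ε} cos (2π θ_p)`. -/
noncomputable def cosSum (θ : Nat.Primes → ℝ) (ε : ℝ) (N : ℕ) : ℝ :=
  ∑ p ∈ primesBelow N, coeff ε p * Real.cos (2 * Real.pi * θ p)

lemma half_add_mem_rightHalfPlane {ε : ℝ} (hε : 0 < ε) :
    ((1 / 2 + ε : ℝ) : ℂ) ∈ rightHalfPlane := by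
  change 1 / 2 < ((1 / 2 + ε : ℝ) : ℂ).re
  rw [ofReal_re]
  linarith

/-- Write `x = x/(1-x) - x²/(1-x)`; the last term is at most `4|x|²` in norm, and after weighting by
`ε log p` its sum over primes is bounded uniformly in `ε`. -/
lemma coeff_mul_cos_le (θ : Nat.Primes → ℝ) {ε : ℝ} (hε : 0 < ε) (p : Nat.Primes) :
    coeff ε p * Real.cos (2 * Real.pi * θ p) ≤
      ε * (Real.log p * eulerTerm θ p ((1 / 2 + ε : ℝ) : ℂ) /
        (1 - eulerTerm θ p ((1 / 2 + ε : ℝ) : ℂ))).re +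
      4 * (ε * (Real.log p * (p : ℝ) ^ (-(1 + 2 * ε)))) := by
  set s : ℂ := ((1 / 2 + ε : ℝ) : ℂ) with hs
  have hsmem : s ∈ rightHalfPlane := half_add_mem_rightHalfPlane hε
  set x := eulerTerm θ p s with hx
  have hxre : x.re = (p : ℝ) ^ (-(1 / 2 + ε)) * Real.cos (2 * Real.pi * θ p) := by
    rw [hx, eulerTerm, hs, ← ofReal_neg, ← ofReal_natCast, ← ofReal_cpow (Nat.cast_nonneg _),
      re_ofReal_mul, unitPoint_re]
  have h1 := norm_one_sub_eulerTerm_ge θ p hsmem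
  rw [← hx] at h1
  have hne : 1 - x ≠ 0 := by
    intro h
    rw [h, norm_zero] at h1
    norm_num at h1
  have hlog : 0 ≤ Real.log p := Real.log_natCast_nonneg _
  have hsplit : (Real.log p : ℂ) * x =
      Real.log p * x / (1 - x) - (Real.log p : ℂ) * (x ^ 2 / (1 - x)) := by
    field_simp
  have hre := congrArg Complex.re hsplit
  rw [sub_re, re_ofReal_mul, re_ofReal_mul, hxre] at hre
  have hxn : ‖x‖ ^ 2 = (p : ℝ) ^ (-(1 + 2 * ε)) := by
    rw [hx, norm_eulerTerm, ← Real.rpow_natCast, ← Real.rpow_mul (Nat.cast_nonneg _), hs, ofReal_re]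
    congr 1; push_cast; ring
  have h2 : -(x ^ 2 / (1 - x)).re ≤ 4 * (p : ℝ) ^ (-(1 + 2 * ε)) := by
    refine (neg_le_abs _).trans ((abs_re_le_norm _).trans ?_)
    rw [norm_div, norm_pow, hxn, div_le_iff₀ (by linarith)]
    have : (0 : ℝ) ≤ (p : ℝ) ^ (-(1 + 2 * ε)) := by positivity
    nlinarith
  have h3 : Real.log p * ((p : ℝ) ^ (-(1 / 2 + ε)) * Real.cos (2 * Real.pi * θ p)) ≤
      (Real.log p * x / (1 - x)).re + Real.log p * (4 * (p : ℝ) ^ (-(1 + 2 * ε))) := by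
    rw [hre]
    have := mul_le_mul_of_nonneg_left h2 hlog
    linarith
  have := mul_le_mul_of_nonneg_left h3 hε.le
  rw [coeff]
  linarith

lemma exists_cosSum_le : ∃ C : ℝ, ∀ (θ : Nat.Primes → ℝ), ∀ ε ∈ Ioc (0 : ℝ) (1 / 2), ∀ N,
    cosSum θ ε N ≤ ε * ‖partialLogDeriv θ N ((1 / 2 + ε : ℝ) : ℂ)‖ + C := by
  obtain ⟨C, hC⟩ := exists_sum_log_bound
  refine ⟨4 * C, fun θ ε hε N => ?_⟩
  have h1 := Finset.sum_le_sum fun p (_ : p ∈ primesBelow N) => coeff_mul_cos_le θ hε.1 p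
  rw [Finset.sum_add_distrib, ← Finset.mul_sum, ← Finset.mul_sum, ← Finset.mul_sum, ← re_sum] at h1
  refine h1.trans (add_le_add ?_ ?_)
  · refine mul_le_mul_of_nonneg_left ?_ hε.1.le
    refine (re_le_norm _).trans (le_of_eq ?_)
    rw [partialLogDeriv, Finset.sum_neg_distrib, norm_neg]
  · exact mul_le_mul_of_nonneg_left (hC ε hε _) (by norm_num)

/-- If `F` is injective on a square adjacent to the critical line, then the normalized random sums
are bounded by a universal constant near the critical line. -/
theorem exists_eventually_cosSum_le_of_injOn :
    ∃ K : ℝ, ∀ θ : Nat.Primes → ℝ, HasBoundedSums θ → ∀ a : ℝ, 0 < a →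
      InjOn (primitive θ) (square a) →
      ∀ᶠ ε in 𝓝[>] (0 : ℝ), ∀ᶠ N in atTop, cosSum θ ε N ≤ K := by
  obtain ⟨C, hC⟩ := exists_cosSum_le
  -- `320` is the univalence constant; the extra `1` leaves room for passing from the limit in `N`
  -- to large `N`.
  refine ⟨321 + C, fun θ hθ a ha hinj => ?_⟩
  obtain ⟨L, hL, hprop⟩ := exists_zetaRand_eq_exp hθ
  have hsmall : ∀ᶠ ε in 𝓝[>] (0 : ℝ), ε < min a (1 / 2) :=
    nhdsWithin_le_nhds (eventually_lt_nhds (by positivity))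
  filter_upwards [hsmall, self_mem_nhdsWithin] with ε hε1 (hε : 0 < ε)
  obtain ⟨hεa, hε2⟩ := lt_min_iff.mp hε1
  set s : ℂ := ((1 / 2 + ε : ℝ) : ℂ) with hs
  have hsmem : s ∈ rightHalfPlane := half_add_mem_rightHalfPlane hε
  have hball : ∀ z ∈ Metric.ball s ε, 1 / 2 < z.re ∧ z.re < 1 / 2 + 2 * ε ∧ |z.im| < ε := by
    intro z hz
    rw [Metric.mem_ball, dist_eq_norm] at hz
    have h1 := abs_lt.mp ((abs_re_le_norm _).trans_lt hz)
    have h2 := (abs_im_le_norm _).trans_lt hz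
    rw [sub_re, hs, ofReal_re] at h1
    rw [sub_im, hs, ofReal_im, sub_zero] at h2
    exact ⟨by linarith [h1.1], by linarith [h1.2], h2⟩
  have hH : Metric.ball s ε ⊆ rightHalfPlane := fun z hz => (hball z hz).1
  have hQ : Metric.ball s ε ⊆ square a := by
    intro z hz
    obtain ⟨h1, h2, h3⟩ := hball z hz
    have h4 := abs_lt.mp h3
    rw [square, mem_reProdIm]
    exact ⟨⟨h1, by linarith⟩, ⟨by linarith, by linarith⟩⟩
  have hkoebe := norm_deriv_le_of_injOn_ball hε (fun z hz => (hprop z (hH hz)).2.2.1)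
    (fun z hz => by rw [(hprop z (hH hz)).2.1]; exact exp_ne_zero _) (hinj.mono hQ)
  have hderiv : deriv (zetaRand θ) s = zetaRand θ s * deriv L s := by
    have h1 : zetaRand θ =ᶠ[𝓝 s] fun z => exp (L z) := by
      filter_upwards [isOpen_rightHalfPlane.mem_nhds hsmem] with z hz using (hprop z hz).2.1
    rw [h1.deriv_eq, (hprop s hsmem).2.1]
    exact ((hL.differentiableAt (isOpen_rightHalfPlane.mem_nhds hsmem)).hasDerivAt.cexp).deriv
  have hpos : 0 < ‖zetaRand θ s‖ := by
    rw [(hprop s hsmem).2.1]; exact norm_pos_iff.mpr (exp_ne_zero _)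
  have hLs : ε * ‖deriv L s‖ ≤ 320 := by
    rw [hderiv, norm_mul, le_div_iff₀ hε] at hkoebe
    have : ‖zetaRand θ s‖ * (ε * ‖deriv L s‖) ≤ ‖zetaRand θ s‖ * 320 := by linarith
    exact le_of_mul_le_mul_left this hpos
  have hlim : Tendsto (fun N => ε * ‖partialLogDeriv θ N s‖) atTop (𝓝 (ε * ‖deriv L s‖)) :=
    (hprop s hsmem).2.2.2.norm.const_mul ε
  filter_upwards [hlim.eventually_lt_const (show ε * ‖deriv L s‖ < 321 by linarith)] with N hN
  linarith [hC θ ε ⟨hε, hε2.le⟩ N]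

end RandomZeta

/-! ### Large values of the random sums: exponential moments and the zero-one law. -/

namespace RandomZeta

open Filter Topology Set MeasureTheory ProbabilityTheory

section Uniform

variable {Ω : Type*} [MeasurableSpace Ω] {P : Measure Ω}

lemma integral_comp_uniform {X : Ω → ℝ} (hX : Measurable X)
    (hu : pdf.IsUniform X (Icc 0 1) P volume) {f : ℝ → ℝ} (hf : Continuous f) :
    ∫ ω, f (X ω) ∂P = ∫ x in (0 : ℝ)..1, f x := by
  rw [← integral_map (φ := X) hX.aemeasurable hf.aestronglyMeasurable, hu,
    ProbabilityTheory.cond, integral_smul_measure, integral_Icc_eq_integral_Ioc,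
    intervalIntegral.integral_of_le zero_le_one]
  simp

lemma integral_cos_two_pi : ∫ x in (0 : ℝ)..1, Real.cos (2 * Real.pi * x) = 0 := by
  rw [intervalIntegral.integral_comp_mul_left (fun x => Real.cos x) (by positivity), integral_cos]
  simp

lemma integral_sin_two_pi : ∫ x in (0 : ℝ)..1, Real.sin (2 * Real.pi * x) = 0 := by
  rw [intervalIntegral.integral_comp_mul_left (fun x => Real.sin x) (by positivity), integral_sin]
  simp

lemma integral_cos_sq_two_pi : ∫ x in (0 : ℝ)..1, Real.cos (2 * Real.pi * x) ^ 2 = 1 / 2 := by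
  rw [intervalIntegral.integral_comp_mul_left (fun x => Real.cos x ^ 2) (by positivity),
    integral_cos_sq]
  simp
  field_simp

lemma exp_le_one_add_add_sq {y : ℝ} (hy : |y| ≤ 1) : Real.exp y ≤ 1 + y + y ^ 2 := by
  have := (abs_le.mp (Real.abs_exp_sub_one_sub_id_le hy)).2
  linarith

lemma one_add_add_sq_div_le_exp {y : ℝ} (hy : |y| ≤ 1) : 1 + y + y ^ 2 / 4 ≤ Real.exp y := by
  have h := (abs_le.mp (Real.exp_bound hy (n := 3) (by norm_num))).1
  simp [Finset.sum_range_succ, Nat.factorial] at h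
  have h2 : |y| ^ 3 ≤ y ^ 2 := by
    rw [← sq_abs y]
    nlinarith [sq_nonneg |y|]
  nlinarith

variable [IsProbabilityMeasure P]

lemma integrable_of_bounded_comp {X : Ω → ℝ} (hX : Measurable X) {f : ℝ → ℝ} (hf : Continuous f)
    {C : ℝ} (hC : ∀ x, |f x| ≤ C) : Integrable (fun ω => f (X ω)) P :=
  Integrable.of_bound (hf.measurable.comp hX).aestronglyMeasurable C
    (ae_of_all _ fun ω => hC (X ω))

/-- The cosine has mean `0` and second moment `1/2`; for `|y| ≤ 1`, `exp y` lies between `1 + y +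
y²/4` and `1 + y + y²`. -/
lemma mgf_cos_bounds {X : Ω → ℝ} (hX : Measurable X)
    (hu : pdf.IsUniform X (Icc 0 1) P volume) {c t : ℝ} (hct : |t * c| ≤ 1) :
    1 + (t * c) ^ 2 / 8 ≤ mgf (fun ω => c * Real.cos (2 * Real.pi * X ω)) P t ∧
      mgf (fun ω => c * Real.cos (2 * Real.pi * X ω)) P t ≤ 1 + (t * c) ^ 2 / 2 := by
  have hcos : Continuous fun x : ℝ => Real.cos (2 * Real.pi * x) := by fun_prop
  have i1 : Integrable (fun ω => Real.cos (2 * Real.pi * X ω)) P :=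
    integrable_of_bounded_comp hX hcos (fun x => Real.abs_cos_le_one _)
  have i2 : Integrable (fun ω => Real.cos (2 * Real.pi * X ω) ^ 2) P :=
    integrable_of_bounded_comp hX (hcos.pow 2) (C := 1) (fun x => by
      rw [Pi.pow_apply, abs_pow]; exact pow_le_one₀ (abs_nonneg _) (Real.abs_cos_le_one _))
  have e1 : ∫ ω, Real.cos (2 * Real.pi * X ω) ∂P = 0 :=
    (integral_comp_uniform hX hu hcos).trans integral_cos_two_pi
  have e2 : ∫ ω, Real.cos (2 * Real.pi * X ω) ^ 2 ∂P = 1 / 2 :=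
    (integral_comp_uniform hX hu (hcos.pow 2)).trans integral_cos_sq_two_pi
  have hy : ∀ x : ℝ, |t * (c * Real.cos (2 * Real.pi * x))| ≤ 1 := by
    intro x
    rw [← mul_assoc, abs_mul]
    exact mul_le_one₀ hct (abs_nonneg _) (Real.abs_cos_le_one _)
  have i3 : Integrable (fun ω => Real.exp (t * (c * Real.cos (2 * Real.pi * X ω)))) P :=
    integrable_of_bounded_comp hX (f := fun x => Real.exp (t * (c * Real.cos (2 * Real.pi * x))))
      (by fun_prop) (C := Real.exp 1) (fun x => by
        rw [Real.abs_exp]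
        exact Real.exp_le_exp.mpr ((le_abs_self _).trans (hy x)))
  have hquad : ∀ d : ℝ, Integrable (fun ω => 1 + t * c * Real.cos (2 * Real.pi * X ω) +
        d * Real.cos (2 * Real.pi * X ω) ^ 2) P ∧
      ∫ ω, (1 + t * c * Real.cos (2 * Real.pi * X ω) + d * Real.cos (2 * Real.pi * X ω) ^ 2) ∂P
        = 1 + d / 2 := by
    intro d
    have j1 : Integrable (fun ω => 1 + t * c * Real.cos (2 * Real.pi * X ω)) P :=
      (integrable_const 1).add (i1.const_mul _)
    refine ⟨j1.add (i2.const_mul _), ?_⟩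
    rw [integral_add j1 (i2.const_mul _), integral_add (integrable_const 1) (i1.const_mul _),
      integral_const_mul, integral_const_mul, e1, e2]
    simp
    ring
  constructor
  · obtain ⟨j, e⟩ := hquad ((t * c) ^ 2 / 4)
    rw [mgf, show 1 + (t * c) ^ 2 / 8 = 1 + (t * c) ^ 2 / 4 / 2 by ring, ← e]
    refine integral_mono j i3 fun ω => ?_
    have := one_add_add_sq_div_le_exp (hy (X ω))
    refine le_trans (le_of_eq ?_) this
    ring
  · obtain ⟨j, e⟩ := hquad ((t * c) ^ 2)
    rw [mgf, ← e]
    refine integral_mono i3 j fun ω => ?_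
    have := exp_le_one_add_add_sq (hy (X ω))
    refine this.trans (le_of_eq ?_)
    ring

/-- A form of the Paley–Zygmund inequality. -/
lemma paley_zygmund {Z : Ω → ℝ} (hZm : Measurable Z) (hZ : Integrable Z P)
    (hZ2 : Integrable (fun ω => Z ω ^ 2) P) {a B : ℝ} (ha : 0 < a) (hB : 0 < B)
    (haZ : a ≤ ∫ ω, Z ω ∂P) (hBZ : ∫ ω, Z ω ^ 2 ∂P ≤ B) :
    a ^ 2 / (4 * B) ≤ P.real {ω | a / 2 ≤ Z ω} := by
  set A := {ω | a / 2 ≤ Z ω} with hA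
  have hAm : MeasurableSet A := measurableSet_le measurable_const hZm
  have hi : Integrable (A.indicator fun _ => B / a) P := (integrable_const _).indicator hAm
  -- A pointwise bound replaces Cauchy–Schwarz: completing the square handles `A`, and `Z < a/2`
  -- holds off `A`.
  have hle : ∀ ω, Z ω ≤ a / 2 + a / (4 * B) * Z ω ^ 2 + A.indicator (fun _ => B / a) ω := by
    intro ω
    by_cases hω : ω ∈ A
    · rw [indicator_of_mem hω]
      have h1 : 0 ≤ a / (4 * B) * (Z ω - 2 * B / a) ^ 2 := by positivity
      have h2 : a / (4 * B) * (Z ω - 2 * B / a) ^ 2 =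
          a / (4 * B) * Z ω ^ 2 - Z ω + B / a := by field_simp; ring
      linarith
    · rw [indicator_of_notMem hω]
      have h1 : 0 ≤ a / (4 * B) * Z ω ^ 2 := by positivity
      have h2 : Z ω < a / 2 := not_le.mp hω
      linarith
  have j1 : Integrable (fun ω => a / 2 + a / (4 * B) * Z ω ^ 2) P :=
    (integrable_const _).add (hZ2.const_mul _)
  have hint : ∫ ω, Z ω ∂P ≤
      ∫ ω, (a / 2 + a / (4 * B) * Z ω ^ 2 + A.indicator (fun _ => B / a) ω) ∂P :=
    integral_mono hZ (j1.add hi) hle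
  have e : ∫ ω, (a / 2 + a / (4 * B) * Z ω ^ 2 + A.indicator (fun _ => B / a) ω) ∂P =
      a / 2 + a / (4 * B) * ∫ ω, Z ω ^ 2 ∂P + P.real A * (B / a) := by
    rw [integral_add j1 hi, integral_add (integrable_const _) (hZ2.const_mul _),
      integral_const_mul, integral_indicator_const _ hAm]
    simp
  rw [e] at hint
  have h3 : a / (4 * B) * ∫ ω, Z ω ^ 2 ∂P ≤ a / 4 := by
    calc _ ≤ a / (4 * B) * B := by gcongr
      _ = a / 4 := by field_simp
  have h4 : a / 4 ≤ P.real A * (B / a) := by linarith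
  calc a ^ 2 / (4 * B) = a / 4 * (a / B) := by field_simp
    _ ≤ P.real A * (B / a) * (a / B) := by gcongr
    _ = P.real A := by field_simp

end Uniform

section Family

variable {Ω : Type*} [MeasurableSpace Ω] {P : Measure Ω} {θ : Nat.Primes → Ω → ℝ}

lemma measurable_cosSum (hmeas : ∀ p, Measurable (θ p)) (ε : ℝ) (N : ℕ) :
    Measurable fun ω => cosSum (fun p => θ p ω) ε N := by
  unfold cosSum
  refine Finset.measurable_sum _ fun p _ => ?_
  have := hmeas p
  fun_prop

lemma mgf_cosSum (hmeas : ∀ p, Measurable (θ p)) (hindep : iIndepFun θ P) (ε : ℝ) (N : ℕ)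
    (t : ℝ) : mgf (fun ω => cosSum (fun p => θ p ω) ε N) P t =
      ∏ p ∈ primesBelow N, mgf (fun ω => coeff ε p * Real.cos (2 * Real.pi * θ p ω)) P t := by
  have hm : ∀ p, Measurable fun x : ℝ => coeff ε p * Real.cos (2 * Real.pi * x) := by
    intro p; fun_prop
  have h := (hindep.comp _ hm).mgf_sum (t := t) (fun p => (hm p).comp (hmeas p)) (primesBelow N)
  have hsum : (∑ p ∈ primesBelow N, (fun x : ℝ => coeff ε p * Real.cos (2 * Real.pi * x)) ∘ θ p) =
      fun ω => cosSum (fun p => θ p ω) ε N := by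
    ext ω
    simp [cosSum]
  rw [hsum] at h
  exact h

lemma measurableSet_frequently {α : Type*} {m : MeasurableSpace α} {A : ℕ → Set α}
    (hA : ∀ n, MeasurableSet[m] (A n)) : MeasurableSet[m] {ω | ∃ᶠ n in atTop, ω ∈ A n} := by
  have hset : {ω | ∃ᶠ n in atTop, ω ∈ A n} = ⋂ n, ⋃ k ≥ n, A k := by
    ext ω
    simp [frequently_atTop]
  rw [hset]
  exact MeasurableSet.iInter fun n => MeasurableSet.iUnion fun k => MeasurableSet.iUnion fun _ => hA k

/-- The condition `limsup_n limsup_N y n N ≥ K`, with iterated limits, for a double sequence. -/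
def LimsupGe (K : ℝ) (y : ℕ → ℕ → ℝ) : Prop :=
  ∀ j : ℕ, ∃ᶠ n in atTop, ∃ᶠ N in atTop, K - 1 / ((j : ℝ) + 1) < y n N

lemma LimsupGe.of_abs_sub_le {K : ℝ} {y z : ℕ → ℕ → ℝ} {r : ℕ → ℝ} (hy : LimsupGe K y)
    (hr : Tendsto r atTop (𝓝 0)) (hyz : ∀ n N, |y n N - z n N| ≤ r n) : LimsupGe K z := by
  intro j
  have hpos : (0 : ℝ) < 1 / (2 * ((j : ℝ) + 1)) := by positivity
  -- The slack at index `2j + 1` is exactly half the slack at `j`; the other half absorbs `r n`.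
  refine ((hy (2 * j + 1)).and_eventually (hr.eventually_lt_const hpos)).mono ?_
  rintro n ⟨hn, hrn⟩
  refine hn.mono fun N hN => ?_
  have h1 := (abs_le.mp (hyz n N)).2
  have h2 : 1 / (((2 * j + 1 : ℕ) : ℝ) + 1) = 1 / (2 * ((j : ℝ) + 1)) := by
    congr 1; push_cast; ring
  have h3 : 1 / ((j : ℝ) + 1) = 1 / (2 * ((j : ℝ) + 1)) + 1 / (2 * ((j : ℝ) + 1)) := by
    field_simp; norm_num
  rw [h2] at hN
  linarith

lemma measurableSet_limsupGe {α : Type*} {m : MeasurableSpace α} {K : ℝ} {y : ℕ → ℕ → α → ℝ}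
    (hy : ∀ n N, Measurable[m] (y n N)) :
    MeasurableSet[m] {ω | LimsupGe K fun n N => y n N ω} := by
  have : {ω | LimsupGe K fun n N => y n N ω} = ⋂ j : ℕ, {ω | ∃ᶠ n in atTop,
      ω ∈ {ω | ∃ᶠ N in atTop, ω ∈ {ω | K - 1 / ((j : ℝ) + 1) < y n N ω}}} := by
    ext ω
    simp [LimsupGe]
  rw [this]
  exact MeasurableSet.iInter fun j => measurableSet_frequently fun n =>
    measurableSet_frequently fun N => measurableSet_lt measurable_const (hy n N)

/-- Dropping a finite set `s` of primes changes the sum by at most `2 ε |s| → 0`, so the event,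
whose definition tolerates vanishing errors, is a tail event and Kolmogorov's law applies. -/
lemma measure_limsupGe_cosSum_eq_zero_or_one (hmeas : ∀ p, Measurable (θ p))
    (hindep : iIndepFun θ P) {ε : ℕ → ℝ} (hε0 : ∀ n, 0 ≤ ε n) (hε : Tendsto ε atTop (𝓝 0))
    (K : ℝ) :
    P {ω | LimsupGe K fun n N => cosSum (fun p => θ p ω) (ε n) N} = 0 ∨
      P {ω | LimsupGe K fun n N => cosSum (fun p => θ p ω) (ε n) N} = 1 := by
  classical
  refine measure_zero_or_one_of_measurableSet_limsup
    (s := fun p => MeasurableSpace.comap (θ p) inferInstance) (f := cofinite)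
    (p := fun t => t.Finite) (ns := fun s : Finset Nat.Primes => (s : Set Nat.Primes))
    (fun p => (hmeas p).comap_le) hindep (fun t ht => ht.compl_mem_cofinite)
    (Monotone.directed_le fun a b hab => by simpa using hab) (fun s => s.finite_toSet)
    (fun p => ⟨{p}, by simp⟩) ?_
  rw [limsup_eq_iInf_iSup]
  simp only [MeasurableSpace.measurableSet_iInf]
  intro t ht
  set s : Finset Nat.Primes := (mem_cofinite.mp ht).toFinset with hs
  have hst : ∀ p, p ∉ s → p ∈ t := by
    intro p hp
    by_contra h
    exact hp (by simpa [hs] using h)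
  set Y : ℕ → ℕ → Ω → ℝ := fun n N ω =>
    ∑ p ∈ primesBelow N with p ∉ s, coeff (ε n) p * Real.cos (2 * Real.pi * θ p ω) with hY
  have hYm : ∀ n N, Measurable[⨆ p ∈ t, MeasurableSpace.comap (θ p) inferInstance] (Y n N) := by
    intro n N
    refine Finset.measurable_sum _ fun p hp => ?_
    have h1 : Measurable[⨆ p ∈ t, MeasurableSpace.comap (θ p) inferInstance] (θ p) :=
      (comap_measurable (θ p)).mono
        (le_iSup₂_of_le p (hst p (Finset.mem_filter.mp hp).2) le_rfl) le_rfl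
    have h2 : Measurable fun x : ℝ => coeff (ε n) p * Real.cos (2 * Real.pi * x) := by fun_prop
    exact h2.comp h1
  have hdiff : ∀ n N ω, |cosSum (fun p => θ p ω) (ε n) N - Y n N ω| ≤ 2 * ε n * s.card := by
    intro n N ω
    have h1 := Finset.sum_filter_add_sum_filter_not (primesBelow N) (fun p => p ∈ s)
      (fun p => coeff (ε n) p * Real.cos (2 * Real.pi * θ p ω))
    have h2 : cosSum (fun p => θ p ω) (ε n) N - Y n N ω =
        ∑ p ∈ primesBelow N with p ∈ s, coeff (ε n) p * Real.cos (2 * Real.pi * θ p ω) := by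
      rw [cosSum, ← h1, hY]
      ring
    rw [h2]
    have hcard : ((primesBelow N).filter fun p => p ∈ s).card ≤ s.card :=
      Finset.card_le_card fun p hp => (Finset.mem_filter.mp hp).2
    calc _ ≤ ∑ p ∈ primesBelow N with p ∈ s, |coeff (ε n) p * Real.cos (2 * Real.pi * θ p ω)| :=
          Finset.abs_sum_le_sum_abs _ _
      _ ≤ ∑ p ∈ primesBelow N with p ∈ s, 2 * ε n := by
          refine Finset.sum_le_sum fun p _ => ?_
          rw [abs_mul, abs_of_nonneg (coeff_nonneg (hε0 n) p)]
          exact (mul_le_of_le_one_right (coeff_nonneg (hε0 n) p) (Real.abs_cos_le_one _)).trans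
            (coeff_le (hε0 n) p)
      _ = 2 * ε n * ((primesBelow N).filter fun p => p ∈ s).card := by
          rw [Finset.sum_const, nsmul_eq_mul]; ring
      _ ≤ _ := by
          have := hε0 n
          gcongr
  have hr : Tendsto (fun n => 2 * ε n * (s.card : ℝ)) atTop (𝓝 0) := by
    simpa using (hε.const_mul 2).mul_const (s.card : ℝ)
  have hset : {ω | LimsupGe K fun n N => cosSum (fun p => θ p ω) (ε n) N} =
      {ω | LimsupGe K fun n N => Y n N ω} := by
    ext ω
    exact ⟨fun h => h.of_abs_sub_le hr fun n N => hdiff n N ω,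
      fun h => h.of_abs_sub_le hr fun n N => by rw [abs_sub_comm]; exact hdiff n N ω⟩
  rw [hset]
  exact measurableSet_limsupGe hYm

variable [IsProbabilityMeasure P]

lemma exp_half_le_one_add {x : ℝ} (h0 : 0 ≤ x) (h1 : x ≤ 1) : Real.exp (x / 2) ≤ 1 + x := by
  have := exp_le_one_add_add_sq (y := x / 2) (by rw [abs_of_nonneg (by linarith)]; linarith)
  nlinarith

/-- Independence makes the moment generating function a product, each factor between two
exponentials of `(t * coeff ε p)^2`. The condition `2εt ≤ 1` ensures `|t * coeff ε p| ≤ 1`. -/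
lemma mgf_cosSum_bounds (hmeas : ∀ p, Measurable (θ p)) (hindep : iIndepFun θ P)
    (hunif : ∀ p, pdf.IsUniform (θ p) (Icc 0 1) P volume) {ε t : ℝ} (hε : 0 < ε) (ht : 0 < t)
    (htε : 2 * ε * t ≤ 1) (N : ℕ) :
    Real.exp (t ^ 2 * (∑ p ∈ primesBelow N, coeff ε p ^ 2) / 16) ≤
        mgf (fun ω => cosSum (fun p => θ p ω) ε N) P t ∧
      mgf (fun ω => cosSum (fun p => θ p ω) ε N) P t ≤
        Real.exp (t ^ 2 * (∑ p ∈ primesBelow N, coeff ε p ^ 2) / 2) := by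
  have hct : ∀ p, |t * coeff ε p| ≤ 1 := by
    intro p
    rw [abs_of_nonneg (mul_nonneg ht.le (coeff_nonneg hε.le p))]
    nlinarith [coeff_le hε.le p]
  have hsum : ∀ d : ℝ, t ^ 2 * (∑ p ∈ primesBelow N, coeff ε p ^ 2) / d =
      ∑ p ∈ primesBelow N, (t * coeff ε p) ^ 2 / d := by
    intro d
    rw [Finset.mul_sum, Finset.sum_div]
    exact Finset.sum_congr rfl fun p _ => by ring
  rw [mgf_cosSum hmeas hindep, hsum, hsum, Real.exp_sum, Real.exp_sum]
  constructor
  · refine Finset.prod_le_prod (fun p _ => (Real.exp_pos _).le) fun p _ => ?_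
    refine le_trans ?_ (mgf_cos_bounds (hmeas p) (hunif p) (hct p)).1
    have h1 : (t * coeff ε p) ^ 2 ≤ 1 := by
      rw [← sq_abs]; exact pow_le_one₀ (abs_nonneg _) (hct p)
    have := exp_half_le_one_add (x := (t * coeff ε p) ^ 2 / 8) (by positivity) (by linarith)
    rwa [show (t * coeff ε p) ^ 2 / 8 / 2 = (t * coeff ε p) ^ 2 / 16 by ring] at this
  · refine Finset.prod_le_prod (fun p _ => mgf_nonneg) fun p _ => ?_
    refine (mgf_cos_bounds (hmeas p) (hunif p) (hct p)).2.trans ?_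
    rw [add_comm]
    exact Real.add_one_le_exp _

lemma abs_cosSum_le (x : Nat.Primes → ℝ) {ε : ℝ} (hε : 0 ≤ ε) (N : ℕ) :
    |cosSum x ε N| ≤ ∑ p ∈ primesBelow N, coeff ε p := by
  refine (Finset.abs_sum_le_sum_abs _ _).trans (Finset.sum_le_sum fun p _ => ?_)
  rw [abs_mul, abs_of_nonneg (coeff_nonneg hε p)]
  exact mul_le_of_le_one_right (coeff_nonneg hε p) (Real.abs_cos_le_one _)

/-- The normalized random sums exceed any given level with probability bounded below. -/
lemma exists_le_measureReal_lt_cosSum (hmeas : ∀ p, Measurable (θ p)) (hindep : iIndepFun θ P)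
    (hunif : ∀ p, pdf.IsUniform (θ p) (Icc 0 1) P volume) {K : ℝ} (hK : 0 ≤ K) :
    ∃ c : ℝ, 0 < c ∧ ∀ᶠ ε in 𝓝[>] (0 : ℝ), ∀ᶠ N in atTop,
      c ≤ P.real {ω | K < cosSum (fun p => θ p ω) ε N} := by
  obtain ⟨C, hC, hV⟩ := exists_tsum_coeff_sq_bounds
  -- The sum of squares is eventually at least `1/32`, so the first moment is at least `exp (t²/512)
  -- = exp (t (K + 2))`; the spare `2t` pays for halving `a`.
  set t : ℝ := 512 * (K + 2) with ht
  have ht0 : 0 < t := by positivity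
  set a : ℝ := Real.exp (t ^ 2 / 512) with ha
  set B : ℝ := Real.exp (2 * t ^ 2 * C) with hB
  refine ⟨a ^ 2 / (4 * B), by positivity, ?_⟩
  have hsmall : ∀ᶠ ε in 𝓝[>] (0 : ℝ), ε < 1 / (4 * t) :=
    nhdsWithin_le_nhds (eventually_lt_nhds (by positivity))
  filter_upwards [hV, hsmall, self_mem_nhdsWithin] with ε hVε hε1 (hε : 0 < ε)
  have hεt : 4 * t * ε < 1 := by
    rw [lt_div_iff₀ (by positivity)] at hε1
    linarith
  have hlim : Tendsto (fun N => ∑ p ∈ primesBelow N, coeff ε p ^ 2) atTop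
      (𝓝 (∑' p, coeff ε p ^ 2)) :=
    (summable_coeff_sq hε).hasSum.comp tendsto_subtype_range_atTop
  filter_upwards [hlim.eventually_const_lt (show (1 : ℝ) / 32 < _ by linarith [hVε.1])] with N hN
  have hVC : ∑ p ∈ primesBelow N, coeff ε p ^ 2 ≤ C :=
    ((summable_coeff_sq hε).sum_le_tsum _ fun p _ => sq_nonneg _).trans hVε.2
  set V := ∑ p ∈ primesBelow N, coeff ε p ^ 2
  set S : Ω → ℝ := fun ω => cosSum (fun p => θ p ω) ε N with hS
  have hSm : Measurable S := measurable_cosSum hmeas ε N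
  have hint : ∀ u : ℝ, 0 ≤ u → Integrable (fun ω => Real.exp (u * S ω)) P := by
    intro u hu
    refine Integrable.of_bound (by fun_prop) (Real.exp (u * ∑ p ∈ primesBelow N, coeff ε p))
      (ae_of_all _ fun ω => ?_)
    rw [Real.norm_eq_abs, Real.abs_exp]
    refine Real.exp_le_exp.mpr (mul_le_mul_of_nonneg_left ?_ hu)
    exact (le_abs_self _).trans (abs_cosSum_le _ hε.le N)
  have hsq : ∀ ω, Real.exp (t * S ω) ^ 2 = Real.exp (2 * t * S ω) := by
    intro ω
    rw [← Real.exp_nat_mul]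
    congr 1; push_cast; ring
  have h1 := (mgf_cosSum_bounds hmeas hindep hunif hε ht0 (by linarith) N).1
  have h2 := (mgf_cosSum_bounds hmeas hindep hunif hε (t := 2 * t) (by linarith) (by linarith) N).2
  have hpz := paley_zygmund (P := P) (Z := fun ω => Real.exp (t * S ω)) (a := a) (B := B)
    (by fun_prop) (hint t ht0.le) (by simp only [hsq]; exact hint _ (by linarith))
    (Real.exp_pos _) (Real.exp_pos _)
    (by
      refine le_trans ?_ h1
      refine Real.exp_le_exp.mpr ?_
      nlinarith [sq_nonneg t])
    (by
      simp only [hsq]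
      refine le_trans h2 ?_
      refine Real.exp_le_exp.mpr ?_
      nlinarith [sq_nonneg t])
  refine hpz.trans (measureReal_mono fun ω hω => ?_)
  change a / 2 ≤ Real.exp (t * S ω) at hω
  change K < S ω
  have h3 : Real.exp (t ^ 2 / 512 - 1) ≤ a / 2 := by
    rw [Real.exp_sub, ← ha]
    have := Real.add_one_le_exp (1 : ℝ)
    exact div_le_div_of_nonneg_left (Real.exp_pos _).le (by norm_num) (by linarith)
  have h4 := Real.exp_le_exp.mp (h3.trans hω)
  by_contra hneg
  push Not at hneg
  have h5 : t * S ω ≤ t * K := mul_le_mul_of_nonneg_left hneg ht0.le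
  have h6 : t ^ 2 / 512 = t * (K + 2) := by rw [ht]; ring
  nlinarith

/-- Reverse Fatou for events: the limsup is a decreasing intersection of unions, each of measure at
least `c` from some point on. -/
lemma le_measure_frequently {A : ℕ → Set Ω} (hA : ∀ n, MeasurableSet (A n)) {c : ENNReal}
    (hc : ∀ᶠ n in atTop, c ≤ P (A n)) : c ≤ P {ω | ∃ᶠ n in atTop, ω ∈ A n} := by
  have hset : {ω | ∃ᶠ n in atTop, ω ∈ A n} = ⋂ n, ⋃ m ≥ n, A m := by
    ext ω
    simp [frequently_atTop]
  rw [hset]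
  have hlim := tendsto_measure_iInter_atTop (μ := P) (s := fun n => ⋃ m ≥ n, A m)
    (fun n => (MeasurableSet.iUnion fun m => MeasurableSet.iUnion fun _ => hA m).nullMeasurableSet)
    (fun a b hab => iUnion_mono fun m => iUnion_mono' fun hm => ⟨le_trans hab hm, le_rfl⟩)
    ⟨0, measure_ne_top _ _⟩
  refine ge_of_tendsto hlim ?_
  filter_upwards [hc] with n hn
  exact hn.trans (measure_mono (subset_iUnion₂_of_subset n le_rfl le_rfl))

/-- Almost surely the normalized random sums exceed any given level arbitrarily close to the
critical line. -/
theorem ae_frequently_lt_cosSum (hmeas : ∀ p, Measurable (θ p)) (hindep : iIndepFun θ P)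
    (hunif : ∀ p, pdf.IsUniform (θ p) (Icc 0 1) P volume) (K : ℝ) :
    ∀ᵐ ω ∂P, ∃ᶠ n : ℕ in atTop, ∃ᶠ N in atTop,
      K < cosSum (fun p => θ p ω) (1 / ((n : ℝ) + 1)) N := by
  wlog hK : 0 ≤ K generalizing K
  · filter_upwards [this 0 le_rfl] with ω hω
    exact hω.mono fun n hn => hn.mono fun N hN => by linarith
  -- Level `K + 1` because `LimsupGe (K + 1)` at `j = 0`, with slack `1`, yields exceedance of `K`.
  obtain ⟨c, hc, hev⟩ := exists_le_measureReal_lt_cosSum hmeas hindep hunif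
    (show 0 ≤ K + 1 by linarith)
  have hlim : Tendsto (fun n : ℕ => 1 / ((n : ℝ) + 1)) atTop (𝓝[>] 0) :=
    tendsto_nhdsWithin_iff.mpr ⟨tendsto_one_div_add_atTop_nhds_zero_nat,
      Eventually.of_forall fun n => by simp only [mem_Ioi]; positivity⟩
  have hm : ∀ n N : ℕ, MeasurableSet
      {ω | K + 1 < cosSum (fun p => θ p ω) (1 / ((n : ℝ) + 1)) N} :=
    fun n N => measurableSet_lt measurable_const (measurable_cosSum hmeas _ N)
  have h1 : ENNReal.ofReal c ≤ P {ω | ∃ᶠ n : ℕ in atTop, ω ∈ {ω | ∃ᶠ N in atTop,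
      ω ∈ {ω | K + 1 < cosSum (fun p => θ p ω) (1 / ((n : ℝ) + 1)) N}}} := by
    refine le_measure_frequently (fun n => measurableSet_frequently (hm n)) ?_
    filter_upwards [hlim.eventually hev] with n hn
    refine le_measure_frequently (hm n) ?_
    filter_upwards [hn] with N hN
    rwa [← ofReal_measureReal, ENNReal.ofReal_le_ofReal_iff measureReal_nonneg]
  have h2 : {ω | ∃ᶠ n : ℕ in atTop, ω ∈ {ω | ∃ᶠ N in atTop,
      ω ∈ {ω | K + 1 < cosSum (fun p => θ p ω) (1 / ((n : ℝ) + 1)) N}}} ⊆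
      {ω | LimsupGe (K + 1) fun n N => cosSum (fun p => θ p ω) (1 / ((n : ℝ) + 1)) N} := by
    intro ω hω j
    refine hω.mono fun n hn => hn.mono fun N (hN : K + 1 < _) => ?_
    have : 0 < 1 / ((j : ℝ) + 1) := by positivity
    linarith
  have h3 := h1.trans (measure_mono h2)
  rcases measure_limsupGe_cosSum_eq_zero_or_one hmeas hindep (P := P) (K := K + 1)
    (ε := fun n : ℕ => 1 / ((n : ℝ) + 1)) (fun n => by positivity)
    tendsto_one_div_add_atTop_nhds_zero_nat with h | h
  · rw [h, nonpos_iff_eq_zero, ENNReal.ofReal_eq_zero] at h3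
    exact absurd hc (not_lt.mpr h3)
  · have hmset : MeasurableSet {ω | LimsupGe (K + 1) fun n N =>
        cosSum (fun p => θ p ω) (1 / ((n : ℝ) + 1)) N} :=
      measurableSet_limsupGe fun n N => measurable_cosSum hmeas _ N
    have hae : ∀ᵐ ω ∂P, LimsupGe (K + 1) fun n N =>
        cosSum (fun p => θ p ω) (1 / ((n : ℝ) + 1)) N :=
      (prob_compl_eq_zero_iff hmset).mpr h
    filter_upwards [hae] with ω hω
    simpa using hω 0

end Family

end RandomZeta

/-! ### Almost sure boundedness of the random sums, and the conclusion. -/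

namespace RandomZeta

open Filter Topology Set MeasureTheory ProbabilityTheory

section Sums

variable {Ω : Type*} [MeasurableSpace Ω] {P : Measure Ω} [IsProbabilityMeasure P]

/-- The partial sums of independent centred bounded random variables with square-summable bounds
are almost surely bounded. -/
theorem ae_exists_abs_sum_range_le {X : ℕ → Ω → ℝ} (hX : ∀ k, Measurable (X k))
    (hindep : iIndepFun X P) (hmean : ∀ k, ∫ ω, X k ω ∂P = 0) {u : ℕ → ℝ}
    (hu : ∀ k ω, |X k ω| ≤ u k) (hsum : Summable fun k => u k ^ 2) :
    ∀ᵐ ω ∂P, ∃ B, ∀ n, |∑ k ∈ Finset.range n, X k ω| ≤ B := by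
  have hsm : ∀ k, StronglyMeasurable (X k) := fun k => (hX k).stronglyMeasurable
  have hmem : ∀ k, MemLp (X k) 2 P := fun k =>
    MemLp.of_bound (hX k).aestronglyMeasurable (u k) (ae_of_all _ (hu k))
  have hint : ∀ k, Integrable (X k) P := fun k => (hmem k).integrable (by norm_num)
  -- Summing through index `n` makes `S n` adapted to the natural filtration at time `n`. It is an
  -- L²-bounded martingale, so it converges almost surely and is bounded.
  set S : ℕ → Ω → ℝ := fun n => ∑ k ∈ Finset.range (n + 1), X k with hS
  have hSmem : ∀ n, MemLp (S n) 2 P := fun n => memLp_finsetSum' _ fun k _ => hmem k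
  have hSint : ∀ n, Integrable (S n) P := fun n => (hSmem n).integrable (by norm_num)
  have hmart : Martingale S (Filtration.natural X hsm) P := by
    refine martingale_of_condExp_sub_eq_zero_nat ?_ hSint fun n => ?_
    · intro n
      refine Finset.stronglyMeasurable_sum _ fun k hk => ?_
      exact (Filtration.stronglyAdapted_natural hsm k).mono
        ((Filtration.natural X hsm).mono (Nat.lt_succ_iff.mp (Finset.mem_range.mp hk)))
    · have h1 : S (n + 1) - S n = X (n + 1) := by
        simp only [hS]
        rw [Finset.sum_range_succ _ (n + 1)]
        simp
      rw [h1]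
      refine (hindep.condExp_natural_ae_eq_of_lt hsm (Nat.lt_succ_self n)).trans ?_
      rw [hmean]
      rfl
  have hSmean : ∀ n, ∫ ω, S n ω ∂P = 0 := by
    intro n
    simp only [hS, Finset.sum_apply]
    rw [integral_finsetSum _ fun k _ => hint k]
    exact Finset.sum_eq_zero fun k _ => hmean k
  have hvar : ∀ n, ∫ ω, S n ω ^ 2 ∂P ≤ ∑' k, u k ^ 2 := by
    intro n
    rw [← variance_of_integral_eq_zero (hSint n).aemeasurable (hSmean n), hS,
      IndepFun.variance_sum (fun k _ => hmem k) fun i _ j _ hij => hindep.indepFun hij]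
    refine le_trans (Finset.sum_le_sum fun k _ => ?_)
      (hsum.sum_le_tsum (Finset.range (n + 1)) fun k _ => sq_nonneg _)
    rw [variance_of_integral_eq_zero (hX k).aemeasurable (hmean k)]
    have h2 := integral_mono (hmem k).integrable_sq (integrable_const (u k ^ 2))
      (fun ω => sq_le_sq' (abs_le.mp (hu k ω)).1 (abs_le.mp (hu k ω)).2)
    simpa using h2
  set R : ℝ := (1 + ∑' k, u k ^ 2) / 2 with hR
  have hbdd : ∀ n, eLpNorm (S n) 1 P ≤ (R.toNNReal : ENNReal) := by
    intro n
    rw [eLpNorm_one_eq_lintegral_enorm, ← ofReal_integral_norm_eq_lintegral_enorm (hSint n)]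
    refine ENNReal.ofReal_le_ofReal ?_
    have h3 : ∫ ω, ‖S n ω‖ ∂P ≤ ∫ ω, (1 / 2 + S n ω ^ 2 / 2) ∂P := by
      refine integral_mono (hSint n).norm
        ((integrable_const _).add ((hSmem n).integrable_sq.div_const 2)) fun ω => ?_
      change ‖S n ω‖ ≤ 1 / 2 + S n ω ^ 2 / 2
      rw [Real.norm_eq_abs, ← sq_abs]
      nlinarith [sq_nonneg (|S n ω| - 1)]
    rw [integral_add (integrable_const _) ((hSmem n).integrable_sq.div_const 2),
      integral_div 2 fun ω => S n ω ^ 2] at h3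
    simp only [integral_const, probReal_univ, smul_eq_mul, one_mul] at h3
    linarith [hvar n]
  filter_upwards [hmart.submartingale.ae_tendsto_limitProcess hbdd] with ω hω
  obtain ⟨B, hB⟩ := (Metric.isBounded_range_of_tendsto _ hω).exists_norm_le
  refine ⟨max B 0, fun n => ?_⟩
  cases n with
  | zero => simp
  | succ n =>
    have := hB _ ⟨n, rfl⟩
    simp only [hS, Finset.sum_apply, Real.norm_eq_abs] at this
    exact this.trans (le_max_left _ _)

/-- The `k`-th prime. -/
noncomputable def nthPrime (k : ℕ) : Nat.Primes := ⟨Nat.nth Nat.Prime k, Nat.prime_nth_prime k⟩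

lemma nthPrime_injective : Function.Injective nthPrime := fun _ _ hab =>
  Nat.nth_injective Nat.infinite_setOfPred_prime (congrArg Subtype.val hab)

/-- Enumerating the primes in increasing order turns sums over `p < N` into partial sums of a
sequence, to which the martingale bound applies. -/
lemma sum_primesBelow_eq_sum_range {M : Type*} [AddCommMonoid M] (f : Nat.Primes → M) (N : ℕ) :
    ∑ p ∈ primesBelow N, f p = ∑ k ∈ Finset.range (Nat.count Nat.Prime N), f (nthPrime k) := by
  symm
  refine Finset.sum_bij (fun k _ => nthPrime k) ?_ (fun a _ b _ h => nthPrime_injective h) ?_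
    (fun _ _ => rfl)
  · intro k hk
    exact Finset.mem_subtype.mpr
      (Finset.mem_range.mpr (Nat.nth_lt_of_lt_count (Finset.mem_range.mp hk)))
  · intro p hp
    have hp' : (p : ℕ) < N := Finset.mem_range.mp (Finset.mem_subtype.mp hp)
    refine ⟨Nat.count Nat.Prime p, Finset.mem_range.mpr (Nat.count_strict_mono p.2 hp'), ?_⟩
    exact Subtype.ext (Nat.nth_count p.2)

lemma ae_exists_abs_sum_primesBelow_le {θ : Nat.Primes → Ω → ℝ} (hmeas : ∀ p, Measurable (θ p))
    (hindep : iIndepFun θ P) (hunif : ∀ p, pdf.IsUniform (θ p) (Icc 0 1) P volume)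
    {σ : ℝ} (hσ : 1 / 2 < σ) {φ : ℝ → ℝ} (hφ : Continuous φ) (hφ1 : ∀ x, |φ x| ≤ 1)
    (hφ0 : ∫ x in (0 : ℝ)..1, φ x = 0) :
    ∀ᵐ ω ∂P, ∃ B, ∀ N, |∑ p ∈ primesBelow N, (p : ℝ) ^ (-σ) * φ (θ p ω)| ≤ B := by
  have hm : ∀ k, Measurable fun x : ℝ => ((nthPrime k : ℕ) : ℝ) ^ (-σ) * φ x :=
    fun k => hφ.measurable.const_mul _
  have hsum : Summable fun k => (((nthPrime k : ℕ) : ℝ) ^ (-σ)) ^ 2 := by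
    have h1 : Summable fun p : Nat.Primes => ((p : ℝ) ^ (-σ)) ^ 2 := by
      refine (Nat.Primes.summable_rpow.mpr (show -(2 * σ) < -1 by linarith)).congr fun p => ?_
      rw [← Real.rpow_natCast, ← Real.rpow_mul (Nat.cast_nonneg _)]
      congr 1; push_cast; ring
    exact h1.comp_injective nthPrime_injective
  have h := ae_exists_abs_sum_range_le (P := P)
    (X := fun k ω => ((nthPrime k : ℕ) : ℝ) ^ (-σ) * φ (θ (nthPrime k) ω))
    (fun k => (hm k).comp (hmeas _)) ((hindep.precomp nthPrime_injective).comp _ hm)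
    (fun k => by
      rw [integral_const_mul, integral_comp_uniform (hmeas _) (hunif _) hφ, hφ0, mul_zero])
    (u := fun k => ((nthPrime k : ℕ) : ℝ) ^ (-σ))
    (fun k ω => by
      rw [abs_mul, abs_of_nonneg (by positivity)]
      exact mul_le_of_le_one_right (by positivity) (hφ1 _)) hsum
  filter_upwards [h] with ω ⟨B, hB⟩
  refine ⟨B, fun N => ?_⟩
  rw [sum_primesBelow_eq_sum_range (fun p => (p : ℝ) ^ (-σ) * φ (θ p ω))]
  exact hB _

theorem ae_hasBoundedSums {θ : Nat.Primes → Ω → ℝ} (hmeas : ∀ p, Measurable (θ p))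
    (hindep : iIndepFun θ P) (hunif : ∀ p, pdf.IsUniform (θ p) (Icc 0 1) P volume) :
    ∀ᵐ ω ∂P, HasBoundedSums fun p => θ p ω := by
  unfold HasBoundedSums
  -- Only countably many abscissae occur, so one null set suffices.
  rw [ae_all_iff]
  intro j
  have hσ : (1 : ℝ) / 2 < 1 / 2 + 1 / (j + 1) := by
    have : (0 : ℝ) < 1 / (j + 1) := by positivity
    linarith
  filter_upwards [
    ae_exists_abs_sum_primesBelow_le hmeas hindep hunif hσ
      (φ := fun x => Real.cos (2 * Real.pi * x)) (by fun_prop) (fun x => Real.abs_cos_le_one _)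
      integral_cos_two_pi,
    ae_exists_abs_sum_primesBelow_le hmeas hindep hunif hσ
      (φ := fun x => Real.sin (2 * Real.pi * x)) (by fun_prop) (fun x => Real.abs_sin_le_one _)
      integral_sin_two_pi] with ω ⟨B, hB⟩ ⟨B', hB'⟩
  refine ⟨B + B', fun N => (Complex.norm_le_abs_re_add_abs_im _).trans (add_le_add ?_ ?_)⟩
  · refine le_trans (le_of_eq ?_) (hB N)
    rw [Complex.re_sum]
    congr 1
    refine Finset.sum_congr rfl fun p _ => ?_
    rw [eulerTerm, ← Complex.ofReal_neg, ← Complex.ofReal_natCast,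
      ← Complex.ofReal_cpow (Nat.cast_nonneg _), Complex.re_ofReal_mul, unitPoint_re]
  · refine le_trans (le_of_eq ?_) (hB' N)
    rw [Complex.im_sum]
    congr 1
    refine Finset.sum_congr rfl fun p _ => ?_
    rw [eulerTerm, ← Complex.ofReal_neg, ← Complex.ofReal_natCast,
      ← Complex.ofReal_cpow (Nat.cast_nonneg _), Complex.im_ofReal_mul, unitPoint_im]

/-- Almost surely `F` is injective on no square adjacent to the critical line. -/
theorem ae_forall_not_injOn_square {θ : Nat.Primes → Ω → ℝ} (hmeas : ∀ p, Measurable (θ p))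
    (hindep : iIndepFun θ P) (hunif : ∀ p, pdf.IsUniform (θ p) (Icc 0 1) P volume) :
    ∀ᵐ ω ∂P, ∀ a : ℝ, 0 < a → ¬ InjOn (primitive fun p => θ p ω) (square a) := by
  -- `K` depends neither on the angles nor on `a`, so a single exceptional null set serves every
  -- square.
  obtain ⟨K, hK⟩ := exists_eventually_cosSum_le_of_injOn
  filter_upwards [ae_hasBoundedSums hmeas hindep hunif,
    ae_frequently_lt_cosSum hmeas hindep hunif K] with ω hb hfreq a ha hinj
  have hlim : Tendsto (fun n : ℕ => 1 / ((n : ℝ) + 1)) atTop (𝓝[>] 0) :=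
    tendsto_nhdsWithin_iff.mpr ⟨tendsto_one_div_add_atTop_nhds_zero_nat,
      Eventually.of_forall fun n => by simp only [mem_Ioi]; positivity⟩
  obtain ⟨n, hn, hn'⟩ :=
    (hfreq.and_eventually (hlim.eventually (hK _ hb a ha hinj))).exists
  obtain ⟨N, hN, hN'⟩ := (hn.and_eventually hn').exists
  exact absurd hN (not_lt.mpr hN')

end Sums

/-- A neighbourhood of the critical line contains a square adjacent to it. -/
lemma exists_square_subset {W : Set ℂ} (hW : W ∈ nhdsSet criticalLine) :
    ∃ a : ℝ, 0 < a ∧ square a ⊆ W ∩ rightHalfPlane := by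
  have h1 : W ∈ 𝓝 ((1 / 2 : ℝ) : ℂ) :=
    mem_nhdsSet_iff_forall.mp hW _ (Complex.ofReal_re _)
  obtain ⟨r, hr, hrW⟩ := Metric.mem_nhds_iff.mp h1
  -- Horizontal distance below `2r/3` and vertical distance below `r/3` keep the square within `r`
  -- of `1/2`.
  refine ⟨r / 3, by positivity, fun z hz => ?_⟩
  rw [square, Complex.mem_reProdIm] at hz
  obtain ⟨⟨h2, h3⟩, h4, h5⟩ := hz
  refine ⟨hrW ?_, h2⟩
  rw [Metric.mem_ball, dist_eq_norm]
  refine (Complex.norm_le_abs_re_add_abs_im _).trans_lt ?_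
  rw [Complex.sub_re, Complex.sub_im, Complex.ofReal_re, Complex.ofReal_im, sub_zero,
    abs_of_pos (by linarith)]
  have : |z.im| < r / 3 := abs_lt.mpr ⟨h4, h5⟩
  linarith

end RandomZeta

theorem proposition1p3 {Ω : Type*} [MeasurableSpace Ω] (P : MeasureTheory.Measure Ω)
    [MeasureTheory.IsProbabilityMeasure P] (θ : Nat.Primes → Ω → ℝ)
    (hmeas : ∀ p, Measurable (θ p))
    (hindep : ProbabilityTheory.iIndepFun θ P)
    (hunif : ∀ p, MeasureTheory.pdf.IsUniform (θ p) (Set.Icc 0 1) P MeasureTheory.volume) :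
    -- almost surely `ζ_rand` is a convergent product on `Re s > 1/2` and `F` is a primitive of it
    (∀ᵐ ω ∂P, ∀ s ∈ RandomZeta.rightHalfPlane,
      Filter.Tendsto (fun N : ℕ => RandomZeta.partialEuler (fun p => θ p ω) N s) Filter.atTop
        (nhds (RandomZeta.zetaRand (fun p => θ p ω) s)) ∧
      HasDerivAt (RandomZeta.primitive (fun p => θ p ω))
        (RandomZeta.zetaRand (fun p => θ p ω) s) s) ∧
    -- `F` is almost surely not injective on the square
    (∀ a : ℝ, 0 < a →
      ∀ᵐ ω ∂P, ¬ Set.InjOn (RandomZeta.primitive (fun p => θ p ω)) (RandomZeta.square a)) ∧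
    -- nor on any neighbourhood of the critical line, to the right of it
    (∀ᵐ ω ∂P, ∀ W ∈ nhdsSet RandomZeta.criticalLine,
      ¬ Set.InjOn (RandomZeta.primitive (fun p => θ p ω)) (W ∩ RandomZeta.rightHalfPlane)) := by
  have hsquare := RandomZeta.ae_forall_not_injOn_square hmeas hindep hunif
  refine ⟨?_, fun a ha => ?_, ?_⟩
  · filter_upwards [RandomZeta.ae_hasBoundedSums hmeas hindep hunif] with ω hω s hs
    obtain ⟨L, -, hL⟩ := RandomZeta.exists_zetaRand_eq_exp hω
    exact ⟨(hL s hs).1, (hL s hs).2.2.1⟩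
  · filter_upwards [hsquare] with ω hω using hω a ha
  · filter_upwards [hsquare] with ω hω W hW hinj
    obtain ⟨a, ha, hsub⟩ := RandomZeta.exists_square_subset hW
    exact hω a ha (hinj.mono hsub)
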